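/- **Setting.** An instance of the Multi-Objective Weighted Shortest Path problem consists of a finite directed graph $(V,E)$, $E\subseteq V\times V$, whose edges $e$ carry $W\ge 1$ non-negative additive objectives $w_e[1],\dots,w_e[W]$, a start node $s\in V$, and $K\ge 1$ coefficient vectors $\lambda_1,\dots,\lambda_K\in\mathbb R_{>0}^W$. Paths may contain loops, $Path_{s,v}$ is the set of paths from $s$ to $v$, and $Cost(p,\lambda)=\sum_{e\in p}\sum_j\lambda[j]\,w_e[j]$. A path $p$ dominates $q$ if it is at most $q$ in every (summed) objective and smaller in at least one; a Pareto path to $v$ is a path in $Path_{s,v}$ that no path in $Path_{s,v}$ dominates. **Algorithm IDAQ.** First a family $pareto\_sample$ is computed by a shortest-path algorithm: for each node $v$ reachable from $s$, a path in $Path_{s,v}$ of minimal cost for $\lambda_1$. The algorithm maintains a queue (initially holding the path $\{s\}$), a list $optimal\_paths$ (initially empty), and the iteration $i$ (initially $1$). $Q_v$ denotes the paths to $v$ in the queue or in $optimal\_paths$. A queued path $p\in Path_{s,v}$ has null priority if some other path $b\in Path_{s,v}$ that is in the queue or was popped has $Cost(b,\lambda_i)<Cost(p,\lambda_i)$, or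 has equal cost and was popped or was pushed before $p$ and is still in the queue; otherwise its priority is $Cost(p,\lambda_i)$. The paths of non-null priority are kept in a Fibonacci heap; priorities are computed when a path is pushed and when a new iteration begins. While the heap is non-empty, a path $p$ of minimal priority is popped and inserted in $optimal\_paths$, and for each out-neighbour $v$ of its end node the path $q=(p,v)$ is *scanned*: 1. If $pareto\_sample[v]$ dominates $q$, then $q$ is dropped. 2. Otherwise, if $|Q_v|<K/W$: if some path in $Q_v$ dominates $q$, then $q$ is dropped; else all paths in $Q_v$ dominated by $q$ are removed (from the queue, the heap and $optimal\_paths$) and $q$ is pushed. 3. Otherwise a list $best_v$, consisting for each $j$ of a path $best_v[j]\in Q_v$ of minimal $\lambda_j$-cost, is used (initialized from $Q_v$ at its first use and kept up to date at every later relevance check that accepts a path): if $Cost(q,\lambda_j)\ge Cost(best_v[j],\lambda_j)$ for all $j$, then $q$ is dropped; else $best_v[j]$ is set to $q$ for every $j$ with $Cost(q,\lambda_j)<Cost(best_v[j],\lambda_j)$, the paths in $Q_v$ that are not in $best_v$ are removed as in 2, and $q$ is pushed. Pushing $q$ appends it to the queue, determines its priority, and, if this is not null, takes all other paths to $v$ out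 of the heap and inserts $q$. When the heap is empty, the algorithm stops if $i=K$; otherwise $i$ is increased by $1$ and all priorities and the heap are recomputed. All ties and orders left open are resolved arbitrarily. *Scanning time.* The scanning time of an execution is the total time of all scans, i.e. of creating $q$, the test against $pareto\_sample[v]$, the relevance check (2 and 3, including the initialization of $best_v$) and the push. Arithmetic operations, comparisons and elementary operations on lists and stored paths cost $1$; heap operations are charged their amortized cost: $1$ for an insertion and $1+\lfloor\log_2 n\rfloor$ for a deletion from a heap of size $n$. (So a dominance test takes time $2W$ and a cost evaluation $2W$.) **Parameters.** Let $\log$ be the logarithm to a fixed base $b>1$. An $l$-node is a node $v$ with at most $l$ Pareto paths to it. $L$ is the least $l\in\mathbb N$ such that the number of $l$-nodes is at least $\left(1-\frac{\log|V|}{|V|}\right)|V|$ (assumed to exist), and $N_L$ is the maximum, over $L$-nodes $v$ and Pareto paths $p$ to $v$, of the number of paths in $Path_{s,v}$ that are not dominated by $p$ (assumed finite). **Theorem P9.** Consider any family of instances along which $|V|\to\infty$ and such that $W=O(1)$; the maximum in-degree and the maximum out-degree are $O(\log|V|)$; $K=O(\sqrt{|V|})$; $N_L=O(L)$; $N_L\le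 K/W$; and $L=O(F(|V|))$ for some function $F$ with $F(n)=o(\log n)$. Then the scanning time of every execution of IDAQ, complete or stopped after any number of developed (popped and fully scanned) paths, is $$O\!\left(|E|\cdot L^2+|V|\cdot\log^2|V|\right).$$ -/

import Mathlib

/-- An instance of the Multi-Objective Weighted Shortest Path problem: a finite directed graph
`(V, E)` whose edges carry `W` non-negative objectives, a start node `s`, and a list of `K`
coefficient vectors, each consisting of `W` positive numbers. -/
structure MOWSP where
  /-- nodes -/
  V : Type*
  [fintypeV : Fintype V]
  /-- directed edges: ordered pairs of nodes -/
  E : Finset (V × V)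
  /-- number of objectives -/
  W : ℕ
  W_pos : 0 < W
  /-- `w e j` is the `j`-th objective of the edge `e` -/
  w : V × V → Fin W → ℝ
  w_nonneg : ∀ e ∈ E, ∀ j, 0 ≤ w e j
  /-- start node -/
  s : V
  /-- number of coefficient vectors -/
  K : ℕ
  K_pos : 0 < K
  /-- the coefficient vectors -/
  coeff : Fin K → Fin W → ℝ
  coeff_pos : ∀ i j, 0 < coeff i j

namespace MOWSP

attribute [instance] MOWSP.fintypeV

noncomputable section

open scoped Classical

/-! ### Paths, costs and dominance -/

/-- A path from `s` (loops allowed) is stored as the list of its nodes, LAST node first: the head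
of the list is the end node of the path, and `u :: p` is the path `p` followed by the node `u`. -/
def IsPath (I : MOWSP) : List I.V → Prop
  | [] => False
  | [v] => v = I.s
  | v :: u :: p => (u, v) ∈ I.E ∧ I.IsPath (u :: p)

/-- The path `p` ends at the node `v`. -/
def EndsAt (I : MOWSP) (v : I.V) (p : List I.V) : Prop := p.head? = some v

/-- The set of paths from `s` to `v`. -/
def pathsTo (I : MOWSP) (v : I.V) : Set (List I.V) := {p | I.IsPath p ∧ I.EndsAt v p}

/-- Sum of the `j`-th objectives of the edges of a path. -/
def objective (I : MOWSP) (j : Fin I.W) : List I.V → ℝ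
  | [] => 0
  | [_] => 0
  | v :: u :: p => I.objective j (u :: p) + I.w (u, v) j

/-- Cost of an edge with respect to the `i`-th coefficient vector. -/
def edgeCost (I : MOWSP) (i : Fin I.K) (e : I.V × I.V) : ℝ := ∑ j, I.coeff i j * I.w e j

/-- Cost of a path with respect to the `i`-th coefficient vector: the sum of its edge costs. -/
def cost (I : MOWSP) (i : Fin I.K) : List I.V → ℝ
  | [] => 0
  | [_] => 0
  | v :: u :: p => I.cost i (u :: p) + I.edgeCost i (u, v)

/-- `p` is an optimal path from `s` to `v` with respect to the `i`-th coefficient vector. -/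
def IsOptimal (I : MOWSP) (i : Fin I.K) (v : I.V) (p : List I.V) : Prop :=
  p ∈ I.pathsTo v ∧ ∀ q ∈ I.pathsTo v, I.cost i p ≤ I.cost i q

/-- Pareto dominance between paths. -/
def Dominates (I : MOWSP) (p q : List I.V) : Prop :=
  (∀ j, I.objective j p ≤ I.objective j q) ∧ ∃ j, I.objective j p < I.objective j q

/-- The Pareto (non-dominated) paths from `s` to `v`. -/
def paretoPaths (I : MOWSP) (v : I.V) : Set (List I.V) :=
  {p | p ∈ I.pathsTo v ∧ ∀ q ∈ I.pathsTo v, ¬ I.Dominates q p}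

/-! ### The parameters of the analysis -/

/-- The set of `l`-nodes: nodes at the end of at most `l` different Pareto paths. -/
def lNodes (I : MOWSP) (l : ℕ) : Finset I.V :=
  Finset.univ.filter fun v => (I.paretoPaths v).encard ≤ (l : ℕ∞)

/-- The ratio of `l`-nodes. -/
def alpha (I : MOWSP) (l : ℕ) : ℝ := ((I.lNodes l).card : ℝ) / (Fintype.card I.V : ℝ)

/-- `l` is the value `L`: the least `l` whose ratio of `l`-nodes is at least
`1 - log |V| / |V|`, the logarithm being taken to the base `b`. -/
def IsL (I : MOWSP) (b : ℝ) (l : ℕ) : Prop :=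
  IsLeast {m : ℕ | I.alpha m ≥
    1 - Real.logb b (Fintype.card I.V : ℝ) / (Fintype.card I.V : ℝ)} l

/-- `N_L(l)`: the maximum, over the `l`-nodes `v` and the Pareto paths `p` to `v`, of the number of
paths to `v` that are not dominated by `p`. -/
def maxNonDominated (I : MOWSP) (l : ℕ) : ℕ∞ :=
  ⨆ v ∈ I.lNodes l, ⨆ p ∈ I.paretoPaths v, {q | q ∈ I.pathsTo v ∧ ¬ I.Dominates p q}.encard

/-- Maximum number of edges leaving a node. -/
def maxOutDegree (I : MOWSP) : ℕ :=
  Finset.univ.sup fun v : I.V => (I.E.filter fun e => e.1 = v).card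

/-- Maximum number of edges entering a node. -/
def maxInDegree (I : MOWSP) : ℕ :=
  Finset.univ.sup fun v : I.V => (I.E.filter fun e => e.2 = v).card

/-! ### The state of IDAQ -/

/-- The data IDAQ maintains. -/
structure State (I : MOWSP) where
  /-- the current iteration (equal to the index of the current coefficient vector) -/
  iter : Fin I.K
  /-- the paths in the Adaptive Queue, in the order in which they were pushed -/
  queue : List (List I.V)
  /-- the Priority Heap: the paths in the Adaptive Queue whose priority is not null -/
  heap : Finset (List I.V)
  /-- the list `optimal_paths` -/
  optimalPaths : List (List I.V)
  /-- all the paths that were popped from the Adaptive Queue so far -/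
  popped : List (List I.V)
  /-- the auxiliary lists `best_v`; `none` as long as `best_v` has not been initialized -/
  best : I.V → Option (Fin I.K → List I.V)

namespace State

variable {I : MOWSP}

/-- `Q_v`: the discovered paths (those in the queue or in `optimal_paths`) that end at `v`. -/
def Q (σ : State I) (v : I.V) : List (List I.V) :=
  (σ.queue ++ σ.optimalPaths).filter fun b => I.EndsAt v b

/-- The priority of `p` is null. -/
def NullPriority (σ : State I) (p : List I.V) : Prop :=
  ∃ b, b ≠ p ∧ b.head? = p.head? ∧
    (((b ∈ σ.queue ∨ b ∈ σ.popped) ∧ I.cost σ.iter b < I.cost σ.iter p) ∨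
      (b ∈ σ.queue ∧ σ.queue.idxOf b < σ.queue.idxOf p ∧
        I.cost σ.iter b = I.cost σ.iter p) ∨
      (b ∈ σ.popped ∧ I.cost σ.iter b = I.cost σ.iter p))

/-- `Adapt(i)`: all priorities and the heap are computed anew for the coefficient vector `i`. -/
def adapt (σ : State I) (i : Fin I.K) : State I :=
  { σ with
    iter := i
    heap := σ.queue.toFinset.filter fun p => ¬ ({ σ with iter := i } : State I).NullPriority p }

/-- Take `p` out of the Adaptive Queue and insert it into `optimal_paths`. -/
def pop (σ : State I) (p : List I.V) : State I :=
  { σ with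
    queue := σ.queue.filter fun b => b ≠ p
    heap := σ.heap.filter fun b => b ≠ p
    optimalPaths := σ.optimalPaths ++ [p]
    popped := σ.popped ++ [p] }

/-- Remove the paths with property `P` from the discovered paths. -/
def remove (σ : State I) (P : List I.V → Prop) : State I :=
  { σ with
    queue := σ.queue.filter fun b => ¬ P b
    heap := σ.heap.filter fun b => ¬ P b
    optimalPaths := σ.optimalPaths.filter fun b => ¬ P b }

/-- Set the list `best_v`. -/
def setBest (σ : State I) (v : I.V) (β : Option (Fin I.K → List I.V)) : State I :=
  { σ with best := Function.update σ.best v β }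

/-- The queue with `q` appended, the priority of `q` not yet being set. -/
def append (σ : State I) (q : List I.V) : State I := { σ with queue := σ.queue ++ [q] }

/-- `Push(q)` for a path `q` ending at `v`: insert `q` into the queue; if its priority is not
null, take the other paths ending at `v` out of the heap and insert `q` into it. -/
def push (σ : State I) (v : I.V) (q : List I.V) : State I :=
  if (σ.append q).NullPriority q then σ.append q
  else { σ.append q with heap := insert q (σ.heap.filter fun b => ¬ I.EndsAt v b) }

end State

/-! ### Running times

Unit cost is charged for every arithmetic operation and every comparison of reals, and for every
elementary operation on stored paths, lists and counters (each path is stored together with its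
objectives, and the lists `Q_v` are kept node by node). Operations of the Fibonacci heap are charged
their amortized times: `1` for an insertion, `1 + log₂ n` for the deletion of an entry of a heap
of size `n`. Loops are charged in full, without early exits. -/

/-- Time of one Pareto-dominance test: two comparisons per objective. -/
def dominanceTime (I : MOWSP) : ℕ := 2 * I.W

/-- Time of evaluating the cost of one path for one coefficient vector: a multiplication and an
addition per objective. -/
def costTime (I : MOWSP) : ℕ := 2 * I.W

namespace State

variable {I : MOWSP}

/-- Time of deleting one entry of the Priority Heap. -/
def heapDeleteTime (σ : State I) : ℕ := 1 + Nat.log 2 σ.heap.card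

/-- Time of removing the paths with property `P`, all ending at `v`, from the discovered paths. -/
def removeTime (σ : State I) (v : I.V) (P : List I.V → Prop) : ℕ :=
  ((σ.Q v).filter fun b => P b).length + (σ.heap.filter fun b => P b).card * σ.heapDeleteTime

/-- Time of `Push(q)` for a path `q` ending at `v`: the insertion into the list of queued paths;
the cost of `q`; the costs of the queued and popped paths ending at `v` and a comparison of each
with the cost of `q`; and, if the priority of `q` is not null, setting the priorities of the paths
in `Q_v` to null, deleting them from the heap, and inserting `q` into the heap. -/
def pushTime (σ : State I) (v : I.V) (q : List I.V) : ℕ :=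
  1 + I.costTime
    + ((σ.queue ++ σ.popped).filter fun b => I.EndsAt v b).length * (I.costTime + 1)
    + if (σ.append q).NullPriority q then 0
      else (σ.Q v).length + (σ.heap.filter fun b => I.EndsAt v b).card * σ.heapDeleteTime + 1

/-! ### Scanning a path -/

/-- Is-Relevant tests for dominance (rather than for optimality) at the node `v`. -/
def TestsDominance (σ : State I) (v : I.V) : Prop :=
  ((σ.Q v).length : ℝ) < (I.K : ℝ) / (I.W : ℝ)

/-- `β` is the list `best_v` that Is-Relevant reads: the stored one, or, when `best_v` has not been
initialized, any choice of cost-minimal paths in `Q_v`, one for each coefficient vector. -/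
def ReadsBest (σ : State I) (v : I.V) (β : Fin I.K → List I.V) : Prop :=
  σ.best v = some β ∨
    (σ.best v = none ∧ ∀ i, β i ∈ σ.Q v ∧ ∀ b ∈ σ.Q v, I.cost i (β i) ≤ I.cost i b)

/-- The time of obtaining `best_v`: if it has to be initialized, all the paths in `Q_v` are
evaluated and compared for each coefficient vector; otherwise the stored costs are read. -/
def bestTime (σ : State I) (v : I.V) : ℕ :=
  if σ.best v = none then (σ.Q v).length * I.K * (I.costTime + 1) else I.K

/-- The list `best_v` after comparing it with the path `q`. -/
def improve (β : Fin I.K → List I.V) (q : List I.V) : Fin I.K → List I.V :=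
  fun i => if I.cost i q < I.cost i (β i) then q else β i

/-- The time of creating a path from its parent (`1` plus `W` additions) and of testing it against
the member of `pareto_sample` with the same end node. -/
def preTime (I : MOWSP) : ℕ := 1 + I.W + I.dominanceTime

/-- The time of the loop of Is-Relevant that computes the `K` costs of a path, compares them with
those of `best_v`, and updates `best_v` or the costs. -/
def improveTime (I : MOWSP) : ℕ := I.K * (I.costTime + 2)

/-- `Scan sample σ v q t σ'`: scanning the path `q`, which ends at `v`, in the state `σ` may take
time `t` and lead to the state `σ'`. -/
inductive Scan (sample : I.V → List I.V) (σ : State I) (v : I.V) (q : List I.V) :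
    ℕ → State I → Prop
  /-- `q` is dominated by the member of `pareto_sample` ending at `v`. -/
  | dominatedBySample (h : I.Dominates (sample v) q) :
      Scan sample σ v q (preTime I) σ
  /-- `|Q_v| < K / W`, and `q` is dominated by a path in `Q_v`. -/
  | dominated (h : ¬ I.Dominates (sample v) q) (hQ : σ.TestsDominance v)
      (hd : ∃ b ∈ σ.Q v, I.Dominates b q) :
      Scan sample σ v q (preTime I + 1 + (σ.Q v).length * I.dominanceTime) σ
  /-- `|Q_v| < K / W`, and `q` is not dominated by `Q_v`: the paths dominated by `q` are removed,
  `best_v` (if in use) is kept up to date, and `q` is pushed. -/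
  | nonDominated (h : ¬ I.Dominates (sample v) q) (hQ : σ.TestsDominance v)
      (hd : ∀ b ∈ σ.Q v, ¬ I.Dominates b q) (σ₁ : State I)
      (hσ₁ : σ₁ = (σ.remove fun b => I.EndsAt v b ∧ I.Dominates q b).setBest v
        ((σ.best v).map fun β => improve β q)) :
      Scan sample σ v q
        (preTime I + 1 + 2 * ((σ.Q v).length * I.dominanceTime)
          + σ.removeTime v (fun b => I.EndsAt v b ∧ I.Dominates q b)
          + (if σ.best v = none then 0 else improveTime I)
          + σ₁.pushTime v q)
        (σ₁.push v q)
  /-- `|Q_v| ≥ K / W`, and `q` improves on `best_v` for no coefficient vector. -/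
  | notBetter (h : ¬ I.Dominates (sample v) q) (hQ : ¬ σ.TestsDominance v)
      (β : Fin I.K → List I.V) (hβ : σ.ReadsBest v β)
      (hb : ∀ i, I.cost i (β i) ≤ I.cost i q) :
      Scan sample σ v q (preTime I + 1 + σ.bestTime v + improveTime I + I.K)
        (σ.setBest v (some β))
  /-- `|Q_v| ≥ K / W`, and `q` improves on `best_v` for some coefficient vector: `best_v` is updated,
  the paths in `Q_v` that are not in `best_v` are removed, and `q` is pushed. -/
  | better (h : ¬ I.Dominates (sample v) q) (hQ : ¬ σ.TestsDominance v)
      (β : Fin I.K → List I.V) (hβ : σ.ReadsBest v β)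
      (hb : ∃ i, I.cost i q < I.cost i (β i)) (σ₁ : State I)
      (hσ₁ : σ₁ = (σ.remove fun b => I.EndsAt v b ∧ b ∉ Set.range (improve β q)).setBest v
        (some (improve β q))) :
      Scan sample σ v q
        (preTime I + 1 + σ.bestTime v + improveTime I + I.K
          + (I.K + (σ.Q v).length)
          + σ.removeTime v (fun b => I.EndsAt v b ∧ b ∉ Set.range (improve β q))
          + σ₁.pushTime v q)
        (σ₁.push v q)

/-- Scanning, one after the other, the extensions of the path `p` by the nodes of a list. -/
inductive ScanList (sample : I.V → List I.V) (p : List I.V) :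
    State I → List I.V → ℕ → State I → Prop
  | nil (σ : State I) : ScanList sample p σ [] 0 σ
  | cons {σ σ₁ σ₂ : State I} {u : I.V} {ns : List I.V} {t₁ t₂ : ℕ}
      (h₁ : Scan sample σ u (u :: p) t₁ σ₁) (h₂ : ScanList sample p σ₁ ns t₂ σ₂) :
      ScanList sample p σ (u :: ns) (t₁ + t₂) σ₂

end State

/-! ### Executions -/

/-- The initial state: the Adaptive Queue holds the path `{s}`, and the iteration is the first. -/
def initialState (I : MOWSP) : State I where
  iter := ⟨0, I.K_pos⟩
  queue := [[I.s]]
  heap := {[I.s]}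
  optimalPaths := []
  popped := []
  best := fun _ => none

/-- `sample` is a possible output of the shortest-path computation from `s` with respect to the
first coefficient vector: for every node reachable from `s`, some shortest path to it. -/
def IsParetoSample (I : MOWSP) (sample : I.V → List I.V) : Prop :=
  ∀ v, (I.pathsTo v).Nonempty → I.IsOptimal ⟨0, I.K_pos⟩ v (sample v)

/-- `Exec I sample t σ`: with the given `pareto_sample`, IDAQ can reach the state `σ`, having spent
the total time `t` on scanning paths. Ties between paths of minimal priority, and the order
in which the neighbours of a node are visited, are resolved arbitrarily. The execution is complete
when the heap is empty in the last iteration. -/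
inductive Exec (I : MOWSP) (sample : I.V → List I.V) : ℕ → State I → Prop
  | init (h : I.IsParetoSample sample) : Exec I sample 0 I.initialState
  /-- No path with non-null priority is left: go on to the next iteration. -/
  | adapt {t : ℕ} {σ : State I} (h : Exec I sample t σ) (hempty : σ.heap = ∅)
      (hlt : (σ.iter : ℕ) + 1 < I.K) :
      Exec I sample t (σ.adapt ⟨(σ.iter : ℕ) + 1, hlt⟩)
  /-- A path `p` of minimal priority is popped, and its extensions by the neighbours `ns` of its
  end node are scanned. -/
  | develop {t t' : ℕ} {σ σ' : State I} (h : Exec I sample t σ) (p : List I.V) (hp : p ∈ σ.heap)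
      (hmin : ∀ q ∈ σ.heap, I.cost σ.iter p ≤ I.cost σ.iter q)
      (v : I.V) (hv : I.EndsAt v p) (ns : List I.V) (hnodup : ns.Nodup)
      (hns : ∀ u, u ∈ ns ↔ (v, u) ∈ I.E)
      (hscan : State.ScanList sample p (σ.pop p) ns t' σ') :
      Exec I sample (t + t') σ'

/-- `t` is the total time spent on scanning paths in some execution of IDAQ, complete or stopped
after some number of developed paths. -/
def IsScanTime (I : MOWSP) (t : ℕ) : Prop := ∃ sample σ, Exec I sample t σ

end

end MOWSP

namespace MOWSP

open scoped Classical

variable {I : MOWSP}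

/-! ### Costs and dominance -/

/-! The argument separates the `l`-nodes, with `l = L`, from the at most `log |V|` remaining nodes
(`numNonLNodes_le`).

A sampled path is optimal for a positive coefficient vector, hence Pareto, so at most `n = N_L`
paths to an `l`-node are undominated by it. Every path that enters the queue has survived the test
against the sample, so an `l`-node never sees more than `n` queued or popped paths. Whenever a fresh
path passes that test there, `|Q_v| < n ≤ K / W`; hence `best_v` is never initialized at an
`l`-node. At any node, the Dijkstra argument shows that at most one path is popped per iteration, so
at most `K` in all, and the relevance check keeps `|Q_v| ≤ K + 1`. All this is carried by
`State.Inv`.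

No path is developed twice, so no path is created twice, and the total time is a sum over pairs of a
popped path and an edge extending it, plus the initializations of the lists `best_v`, which are paid
by a potential, the number of initialized lists (`State.Inv.scan`, `Exec.exists_inv`).
`Exec.time_le` then counts. There are at most `n |E| + K · dout · log |V|` scans, each costing
`O(W)` up to the sample test. At most `n |V|` scans pass that test at `l`-nodes, at cost `O(W (n +
log |V|))` each. At most `K · din · log |V|` scans reach other nodes, at cost `O(W (K + log |V|))`
each. At most `log |V|` initializations cost `O(W K²)` each. Inserting the growth assumptions
(`time_bound_aux`) gives the claim. -/

theorem edgeCost_nonneg (i : Fin I.K) {e : I.V × I.V} (he : e ∈ I.E) : 0 ≤ I.edgeCost i e :=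
  Finset.sum_nonneg fun j _ => mul_nonneg (I.coeff_pos i j).le (I.w_nonneg e he j)

theorem cost_eq_sum (i : Fin I.K) :
    ∀ p : List I.V, I.cost i p = ∑ j, I.coeff i j * I.objective j p
  | [] => by simp [cost, objective]
  | [_] => by simp [cost, objective]
  | v :: u :: p => by
    simp only [cost, objective, edgeCost, cost_eq_sum i (u :: p), mul_add, Finset.sum_add_distrib]

theorem Dominates.cost_lt {p q : List I.V} (h : I.Dominates p q) (i : Fin I.K) :
    I.cost i p < I.cost i q := by
  rw [cost_eq_sum, cost_eq_sum]
  obtain ⟨h, j, hj⟩ := h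
  exact Finset.sum_lt_sum (fun j _ => mul_le_mul_of_nonneg_left (h j) (I.coeff_pos i j).le)
    ⟨j, Finset.mem_univ j, mul_lt_mul_of_pos_left hj (I.coeff_pos i j)⟩

/-- A dominating path would be strictly cheaper, because the coefficients are positive. -/
theorem IsOptimal.mem_paretoPaths {i : Fin I.K} {v : I.V} {p : List I.V}
    (h : I.IsOptimal i v p) : p ∈ I.paretoPaths v :=
  ⟨h.1, fun q hq hd => (h.2 q hq).not_gt (hd.cost_lt i)⟩

theorem objective_nonneg (j : Fin I.W) : ∀ p : List I.V, I.IsPath p → 0 ≤ I.objective j p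
  | [], h => h.elim
  | [_], _ => le_rfl
  | _ :: u :: p, h => add_nonneg (objective_nonneg j (u :: p) h.2) (I.w_nonneg _ h.1 j)

theorem isPath_cons {u v : I.V} {p : List I.V} (hp : I.IsPath p) (hv : I.EndsAt v p)
    (he : (v, u) ∈ I.E) : I.IsPath (u :: p) := by
  cases p with
  | nil => exact hp.elim
  | cons a p =>
    obtain rfl : a = v := by simpa [EndsAt] using hv
    exact ⟨he, hp⟩

theorem cost_le_cost_cons (i : Fin I.K) {u v : I.V} {p : List I.V} (hv : I.EndsAt v p)
    (he : (v, u) ∈ I.E) : I.cost i p ≤ I.cost i (u :: p) := by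
  cases p with
  | nil => simp [EndsAt] at hv
  | cons a p =>
    obtain rfl : a = v := by simpa [EndsAt] using hv
    exact le_add_of_nonneg_right (edgeCost_nonneg i he)

/-- The start path is queued without being tested against the sample; since its objectives vanish,
it satisfies the same invariant as the tested paths. -/
theorem not_dominates_start {p : List I.V} (hp : I.IsPath p) : ¬ I.Dominates p [I.s] :=
  fun ⟨_, j, hj⟩ => (objective_nonneg j p hp).not_gt (by simpa [objective] using hj)

theorem start_mem_pathsTo (I : MOWSP) : [I.s] ∈ I.pathsTo I.s := ⟨rfl, rfl⟩

theorem EndsAt.unique {u v : I.V} {p : List I.V} (hu : I.EndsAt u p) (hv : I.EndsAt v p) :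
    u = v := Option.some.inj (hu.symm.trans hv)

theorem IsPath.exists_endsAt {p : List I.V} (hp : I.IsPath p) : ∃ v, I.EndsAt v p := by
  cases p with
  | nil => exact hp.elim
  | cons v p => exact ⟨v, rfl⟩

/-- The paths to `v` that are not dominated by the sampled path to `v`. -/
def undominated (sample : I.V → List I.V) (v : I.V) : Set (List I.V) :=
  {q | q ∈ I.pathsTo v ∧ ¬ I.Dominates (sample v) q}

theorem IsParetoSample.encard_undominated_le {sample : I.V → List I.V}
    (h : I.IsParetoSample sample) {l : ℕ} {v : I.V} (hv : v ∈ I.lNodes l) :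
    (undominated sample v).encard ≤ I.maxNonDominated l := by
  -- At an unreachable node the sample is arbitrary, but there is nothing to count.
  rcases (I.pathsTo v).eq_empty_or_nonempty with h0 | h0
  · have : undominated sample v = ∅ := by simp [undominated, h0]
    simp [this]
  · exact (le_iSup₂ (f := fun p _ => {q | q ∈ I.pathsTo v ∧ ¬ I.Dominates p q}.encard)
      (sample v) (h v h0).mem_paretoPaths).trans (le_iSup₂ (f := fun v _ =>
        ⨆ p ∈ I.paretoPaths v, {q | q ∈ I.pathsTo v ∧ ¬ I.Dominates p q}.encard) v hv)

theorem _root_.Finset.card_le_of_encard_le {α : Type*} {s : Finset α} {S : Set α} {n : ℕ}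
    (h : ∀ a ∈ s, a ∈ S) (hS : S.encard ≤ n) : s.card ≤ n := by
  have := (Set.encard_le_encard (s := (s : Set α)) h).trans hS
  rw [Set.encard_coe_eq_coe_finsetCard] at this
  exact_mod_cast this

theorem _root_.List.Nodup.length_le_of_encard_le {α : Type*} {l : List α} {S : Set α} {n : ℕ}
    (hl : l.Nodup) (h : ∀ a ∈ l, a ∈ S) (hS : S.encard ≤ n) : l.length ≤ n := by
  rw [← List.toFinset_card_of_nodup hl]
  exact Finset.card_le_of_encard_le (fun a ha => h a (by simpa using ha)) hS

/-! ### Invariants of the state -/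

namespace State

theorem mem_Q {σ : State I} {v : I.V} {b : List I.V} :
    b ∈ σ.Q v ↔ (b ∈ σ.queue ∨ b ∈ σ.optimalPaths) ∧ I.EndsAt v b := by
  simp [Q, or_and_right]

theorem Q_remove (σ : State I) (P : List I.V → Prop) (v : I.V) :
    (σ.remove P).Q v = (σ.Q v).filter fun b => ¬ P b := by
  simp only [Q, remove, ← List.filter_append, List.filter_filter, Bool.and_comm]

theorem Q_setBest (σ : State I) (u v : I.V) (β : Option (Fin I.K → List I.V)) :
    (σ.setBest u β).Q v = σ.Q v := rfl

theorem push_queue (σ : State I) (v : I.V) (q : List I.V) :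
    (σ.push v q).queue = σ.queue ++ [q] := by
  unfold push; split <;> rfl

theorem push_iter (σ : State I) (v : I.V) (q : List I.V) : (σ.push v q).iter = σ.iter := by
  unfold push; split <;> rfl

theorem push_popped (σ : State I) (v : I.V) (q : List I.V) : (σ.push v q).popped = σ.popped := by
  unfold push; split <;> rfl

theorem push_optimalPaths (σ : State I) (v : I.V) (q : List I.V) :
    (σ.push v q).optimalPaths = σ.optimalPaths := by
  unfold push; split <;> rfl

theorem push_best (σ : State I) (v : I.V) (q : List I.V) : (σ.push v q).best = σ.best := by
  unfold push; split <;> rfl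

theorem length_Q_push (σ : State I) (u v : I.V) (q : List I.V) :
    ((σ.push u q).Q v).length = (σ.Q v).length + if I.EndsAt v q then 1 else 0 := by
  simp only [Q, push_queue, push_optimalPaths, List.filter_append, List.length_append,
    List.filter_cons, List.filter_nil, decide_eq_true_eq]
  split <;> (simp; try omega)

theorem mem_heap_push {σ : State I} {v : I.V} {q b : List I.V} (hb : b ∈ (σ.push v q).heap) :
    (b ∈ σ.heap ∧ ((σ.append q).NullPriority q ∨ ¬ I.EndsAt v b)) ∨
      (b = q ∧ ¬ (σ.append q).NullPriority q) := by
  unfold push at hb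
  split at hb
  · exact .inl ⟨hb, .inl ‹_›⟩
  · simp only [Finset.mem_insert, Finset.mem_filter] at hb
    tauto

theorem mem_scan_queue_or_popped {σ : State I} {q b : List I.V} {v : I.V}
    (h : b ∈ (σ.push v q).queue ∨ b ∈ (σ.push v q).popped) :
    (b ∈ σ.queue ∨ b ∈ σ.popped) ∨ b = q := by
  simp only [push_queue, push_popped, List.mem_append, List.mem_singleton] at h
  tauto

/-- The invariants of IDAQ. All the paths discovered so far lie in `R`; the priorities in the heap
are at least `c`; and `D` contains the end nodes of the paths popped in the current iteration. -/
structure Inv (sample : I.V → List I.V) (l : ℕ) (R : Set (List I.V)) (c : ℝ) (D : Set I.V)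
    (σ : State I) : Prop where
  queue_nodup : σ.queue.Nodup
  popped_nodup : σ.popped.Nodup
  optimalPaths_nodup : σ.optimalPaths.Nodup
  optimalPaths_subset : ∀ b ∈ σ.optimalPaths, b ∈ σ.popped
  disjoint : ∀ b ∈ σ.queue, b ∉ σ.popped
  mem_seen : ∀ b, b ∈ σ.queue ∨ b ∈ σ.popped → b ∈ R
  isPath : ∀ b, b ∈ σ.queue ∨ b ∈ σ.popped → I.IsPath b
  not_dominates : ∀ b, b ∈ σ.queue ∨ b ∈ σ.popped → ∀ v, I.EndsAt v b →
    ¬ I.Dominates (sample v) b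
  heap_subset : ∀ b ∈ σ.heap, b ∈ σ.queue
  heap_inj : ∀ b ∈ σ.heap, ∀ b' ∈ σ.heap, b.head? = b'.head? → b = b'
  le_heap : ∀ b ∈ σ.heap, c ≤ I.cost σ.iter b
  done : ∀ v ∈ D, (∀ b ∈ σ.heap, ¬ I.EndsAt v b) ∧
    ∃ b ∈ σ.popped, I.EndsAt v b ∧ I.cost σ.iter b ≤ c
  count : ∀ v, (σ.popped.filter fun b => I.EndsAt v b).length ≤
    (σ.iter : ℕ) + if v ∈ D then 1 else 0
  length_Q : ∀ v, (σ.Q v).length ≤ I.K + 1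
  best_none : ∀ v ∈ I.lNodes l, σ.best v = none

/-! ### Preservation of the invariants by the operations of IDAQ -/

namespace Inv

variable {sample : I.V → List I.V} {l : ℕ} {R : Set (List I.V)} {c : ℝ} {D : Set I.V}
  {σ : State I}

theorem mono (h : Inv sample l R c D σ) {R' : Set (List I.V)} (hR : R ⊆ R') :
    Inv sample l R' c D σ :=
  { h with mem_seen := fun b hb => hR (h.mem_seen b hb) }

/-- Removal may delete a path from `optimalPaths` but never from `popped`, so the witnesses in
`done` and the count of pops survive. -/
theorem remove (h : Inv sample l R c D σ) (P : List I.V → Prop) :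
    Inv sample l R c D (σ.remove P) where
  queue_nodup := h.queue_nodup.filter _
  popped_nodup := h.popped_nodup
  optimalPaths_nodup := h.optimalPaths_nodup.filter _
  optimalPaths_subset b hb := h.optimalPaths_subset b (List.mem_of_mem_filter hb)
  disjoint b hb := h.disjoint b (List.mem_of_mem_filter hb)
  mem_seen b hb := h.mem_seen b (hb.imp_left List.mem_of_mem_filter)
  isPath b hb := h.isPath b (hb.imp_left List.mem_of_mem_filter)
  not_dominates b hb := h.not_dominates b (hb.imp_left List.mem_of_mem_filter)
  heap_subset b hb := by
    have hb := Finset.mem_filter.1 hb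
    exact List.mem_filter.2 ⟨h.heap_subset b hb.1, by simpa using hb.2⟩
  heap_inj b hb b' hb' :=
    h.heap_inj b (Finset.mem_of_mem_filter b hb) b' (Finset.mem_of_mem_filter b' hb')
  le_heap b hb := h.le_heap b (Finset.mem_of_mem_filter b hb)
  done v hv := ⟨fun b hb => (h.done v hv).1 b (Finset.mem_of_mem_filter b hb), (h.done v hv).2⟩
  count := h.count
  length_Q v := by
    rw [Q_remove]
    exact (List.length_filter_le _ _).trans (h.length_Q v)
  best_none := h.best_none

theorem setBest (h : Inv sample l R c D σ) (v : I.V) (β : Option (Fin I.K → List I.V))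
    (hv : v ∈ I.lNodes l → β = none) : Inv sample l R c D (σ.setBest v β) :=
  { h with
    best_none := fun u hu => by
      by_cases huv : u = v
      · subst huv; simpa [State.setBest] using hv hu
      · simpa [State.setBest, huv] using h.best_none u hu }

/-- Freshness, `q ∉ R`, keeps the lists duplicate-free. The bound `K` on `|Q_v|` before the push
leaves room for one more path. -/
theorem push (h : Inv sample l R c D σ) {v : I.V} {q : List I.V} (hqR : q ∉ R)
    (hq : I.IsPath q) (hv : I.EndsAt v q) (hs : ¬ I.Dominates (sample v) q)
    (hc : c ≤ I.cost σ.iter q) (hQ : (σ.Q v).length ≤ I.K) :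
    Inv sample l (insert q R) c D (σ.push v q) where
  queue_nodup := by
    rw [push_queue]
    refine h.queue_nodup.append (List.nodup_singleton q) ?_
    simpa using fun hm => hqR (h.mem_seen q (.inl hm))
  popped_nodup := by rw [push_popped]; exact h.popped_nodup
  optimalPaths_nodup := by rw [push_optimalPaths]; exact h.optimalPaths_nodup
  optimalPaths_subset := by
    rw [push_optimalPaths, push_popped]; exact h.optimalPaths_subset
  disjoint b hb := by
    rw [push_queue, List.mem_append, List.mem_singleton] at hb
    rw [push_popped]
    rcases hb with hb | rfl
    · exact h.disjoint b hb
    · exact fun hm => hqR (h.mem_seen b (.inr hm))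
  mem_seen b hb := by
    rcases mem_scan_queue_or_popped hb with hb | rfl
    · exact .inr (h.mem_seen b hb)
    · exact .inl rfl
  isPath b hb := by
    rcases mem_scan_queue_or_popped hb with hb | rfl
    · exact h.isPath b hb
    · exact hq
  not_dominates b hb u hu := by
    rcases mem_scan_queue_or_popped hb with hb | rfl
    · exact h.not_dominates b hb u hu
    · exact hu.unique hv ▸ hs
  heap_subset b hb := by
    rw [push_queue, List.mem_append, List.mem_singleton]
    rcases mem_heap_push hb with ⟨hb, -⟩ | ⟨rfl, -⟩
    · exact .inl (h.heap_subset b hb)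
    · exact .inr rfl
  heap_inj b hb b' hb' hbb' := by
    rcases mem_heap_push hb with ⟨hb, hn⟩ | ⟨rfl, hn⟩ <;>
      rcases mem_heap_push hb' with ⟨hb', hn'⟩ | ⟨rfl, hn'⟩
    · exact h.heap_inj b hb b' hb' hbb'
    · exact absurd (hbb'.trans hv) (hn.resolve_left hn')
    · exact absurd (hbb'.symm.trans hv) (hn'.resolve_left hn)
    · rfl
  le_heap b hb := by
    rw [push_iter]
    rcases mem_heap_push hb with ⟨hb, -⟩ | ⟨rfl, -⟩
    · exact h.le_heap b hb
    · exact hc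
  done u hu := by
    obtain ⟨h₁, b, hb, hub, hbc⟩ := h.done u hu
    rw [push_popped, push_iter]
    refine ⟨fun b' hb' hub' => ?_, b, hb, hub, hbc⟩
    rcases mem_heap_push hb' with ⟨hb', -⟩ | ⟨rfl, hn⟩
    · exact h₁ b' hb' hub'
    -- A path to `u` popped earlier in this iteration costs at most `c`, hence at most as much as
    -- the new path; even in a tie the popped path makes the new priority null.
    · refine hn ⟨b, ?_, hub.trans hub'.symm, ?_⟩
      · rintro rfl
        exact hqR (h.mem_seen b (.inr hb))
      · rcases (hbc.trans hc).lt_or_eq with hlt | heq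
        · exact .inl ⟨.inr hb, hlt⟩
        · exact .inr (.inr ⟨hb, heq⟩)
  count u := by rw [push_popped, push_iter]; exact h.count u
  length_Q u := by
    rw [length_Q_push]
    split_ifs with hu
    · obtain rfl := hu.unique hv
      omega
    · exact h.length_Q u
  best_none := by rw [push_best]; exact h.best_none

/-- This is Dijkstra's argument: the cost of the popped path becomes the new lower bound for the
heap, and its end node is settled for the rest of the iteration, since the heap holds at most one
path per node. -/
theorem pop (h : Inv sample l R c D σ) {p : List I.V} {v : I.V} (hp : p ∈ σ.heap)
    (hmin : ∀ q ∈ σ.heap, I.cost σ.iter p ≤ I.cost σ.iter q) (hv : I.EndsAt v p) :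
    Inv sample l R (I.cost σ.iter p) (insert v D) (σ.pop p) := by
  have hpq := h.heap_subset p hp
  have hpp := h.disjoint p hpq
  have hmem : ∀ b, b ∈ (σ.pop p).queue ∨ b ∈ (σ.pop p).popped → b ∈ σ.queue ∨ b ∈ σ.popped := by
    intro b hb
    simp only [State.pop, List.mem_filter, List.mem_append, List.mem_singleton] at hb
    rcases hb with hb | hb | rfl
    exacts [.inl hb.1, .inr hb, .inl hpq]
  refine ⟨h.queue_nodup.filter _, ?_, ?_, ?_, ?_, fun b hb => h.mem_seen b (hmem b hb),
    fun b hb => h.isPath b (hmem b hb), fun b hb => h.not_dominates b (hmem b hb), ?_, ?_, ?_, ?_,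
    ?_, ?_, h.best_none⟩
  · refine h.popped_nodup.append (List.nodup_singleton p) ?_
    simpa using hpp
  · refine h.optimalPaths_nodup.append (List.nodup_singleton p) ?_
    simpa using fun hm => hpp (h.optimalPaths_subset p hm)
  · intro b hb
    simp only [State.pop, List.mem_append, List.mem_singleton] at hb ⊢
    exact hb.imp_left (h.optimalPaths_subset b)
  · intro b hb
    simp only [State.pop, List.mem_append, List.mem_singleton, List.mem_filter,
      decide_eq_true_eq] at hb ⊢
    exact not_or.2 ⟨h.disjoint b hb.1, hb.2⟩
  · intro b hb
    have hb := Finset.mem_filter.1 hb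
    exact List.mem_filter.2 ⟨h.heap_subset b hb.1, by simpa using hb.2⟩
  · intro b hb b' hb'
    exact h.heap_inj b (Finset.mem_of_mem_filter b hb) b' (Finset.mem_of_mem_filter b' hb')
  · intro b hb
    exact hmin b (Finset.mem_of_mem_filter b hb)
  · rintro u (rfl | hu)
    · refine ⟨fun b hb hub => ?_, p, by simp [State.pop], hv, le_rfl⟩
      have hb := Finset.mem_filter.1 hb
      exact hb.2 (h.heap_inj b hb.1 p hp (hub.trans hv.symm))
    · obtain ⟨h₁, b, hb, hub, hbc⟩ := h.done u hu
      exact ⟨fun b hb => h₁ b (Finset.mem_of_mem_filter b hb), b, by simp [State.pop, hb], hub,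
        hbc.trans (h.le_heap p hp)⟩
  · intro u
    have hu := h.count u
    -- A settled node has no path in the heap, so this is the first pop at `v` in the iteration.
    have hvD : v ∉ D := fun hD => (h.done v hD).1 p hp hv
    simp only [State.pop, List.filter_append, List.length_append, List.filter_cons,
      List.filter_nil, decide_eq_true_eq, Set.mem_insert_iff]
    by_cases huv : u = v
    · subst huv
      simpa [hv, hvD] using hu
    · have : ¬ I.EndsAt u p := fun hup => huv (hup.unique hv)
      simpa [this, huv] using hu
  · intro u
    -- The popped path moves from the queue to `optimalPaths`, so `Q_u` changes only by a
    -- permutation.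
    refine le_trans (List.Perm.length_eq (List.Perm.filter _ ?_)).le (h.length_Q u)
    have h₁ : σ.queue.Perm (p :: (σ.pop p).queue) := by
      have := List.perm_cons_erase hpq
      rw [h.queue_nodup.erase_eq_filter] at this
      rwa [show σ.queue.filter (fun b => b != p) = (σ.pop p).queue from
        List.filter_congr fun b _ => by simp [bne, Bool.beq_eq_decide_eq]] at this
    have h₂ : (σ.pop p).optimalPaths.Perm (p :: σ.optimalPaths) :=
      List.perm_append_singleton p _
    refine (h₂.append_left _).trans (List.Perm.trans ?_ (h₁.symm.append_right _))
    exact List.perm_middle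

/-- The term counting the current iteration's pop is absorbed by the increase of `iter`, so `D` can
restart empty. Any lower bound for the finite recomputed heap serves as `c'`. -/
theorem adapt (h : Inv sample l R c D σ) (hlt : (σ.iter : ℕ) + 1 < I.K) :
    ∃ c', Inv sample l R c' ∅ (σ.adapt ⟨(σ.iter : ℕ) + 1, hlt⟩) := by
  set σ' := σ.adapt ⟨(σ.iter : ℕ) + 1, hlt⟩ with hσ'
  have hheap : ∀ b ∈ σ'.heap, b ∈ σ.queue ∧ ¬ σ'.NullPriority b := by
    intro b hb
    have hb := Finset.mem_filter.1 hb
    exact ⟨List.mem_toFinset.1 hb.1, hb.2⟩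
  obtain ⟨c', hc'⟩ : ∃ c', ∀ b ∈ σ'.heap, c' ≤ I.cost σ'.iter b := by
    obtain ⟨c', hc'⟩ := (σ'.heap.image (I.cost σ'.iter)).bddBelow
    exact ⟨c', fun b hb => hc' (Finset.mem_coe.2 (Finset.mem_image_of_mem _ hb))⟩
  refine ⟨c', h.queue_nodup, h.popped_nodup, h.optimalPaths_nodup, h.optimalPaths_subset,
    h.disjoint, h.mem_seen, h.isPath, h.not_dominates, fun b hb => (hheap b hb).1, ?_, hc', ?_, ?_,
    h.length_Q, h.best_none⟩
  · intro b hb b' hb' hbb'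
    by_contra hne
    obtain ⟨hq, hn⟩ := hheap b hb
    obtain ⟨hq', hn'⟩ := hheap b' hb'
    rcases lt_trichotomy (I.cost σ'.iter b) (I.cost σ'.iter b') with hlt | heq | hgt
    · exact hn' ⟨b, hne, hbb', .inl ⟨.inl hq, hlt⟩⟩
    -- Equal costs are separated by the order of pushing, which is strict between distinct queued
    -- paths.
    · have hidx : σ.queue.idxOf b ≠ σ.queue.idxOf b' := fun e => hne ((List.idxOf_inj hq).1 e)
      rcases hidx.lt_or_gt with hi | hi
      · exact hn' ⟨b, hne, hbb', .inr (.inl ⟨hq, hi, heq⟩)⟩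
      · exact hn ⟨b', Ne.symm hne, hbb'.symm, .inr (.inl ⟨hq', hi, heq.symm⟩)⟩
    · exact hn ⟨b', Ne.symm hne, hbb'.symm, .inl ⟨.inl hq', hgt⟩⟩
  · simp
  · intro v
    have := h.count v
    refine this.trans ?_
    simp only [hσ', State.adapt, Set.mem_empty_iff_false, if_false]
    split_ifs <;> omega

theorem init (hs : I.IsParetoSample sample) (l : ℕ) : Inv sample l {[I.s]} 0 ∅ I.initialState where
  queue_nodup := List.nodup_singleton _
  popped_nodup := List.nodup_nil
  optimalPaths_nodup := List.nodup_nil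
  optimalPaths_subset := by simp [initialState]
  disjoint := by simp [initialState]
  mem_seen := by simp [initialState]
  isPath := by simp [initialState, IsPath]
  not_dominates := by
    rintro b hb v hv
    obtain rfl : b = [I.s] := by simpa [initialState] using hb
    obtain rfl : I.s = v := by simpa [EndsAt] using hv
    exact not_dominates_start (hs _ ⟨_, I.start_mem_pathsTo⟩).1.1
  heap_subset := by simp [initialState]
  heap_inj := by simp [initialState]
  le_heap := by simp [initialState, cost]
  done := by simp
  count := by simp [initialState]
  length_Q v := by
    have := I.K_pos
    refine (List.length_filter_le _ _).trans ?_
    simp [initialState]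
  best_none _ _ := rfl

/-! #### Sizes of the lists of the state -/

/-- Iterations are numbered from `0`, so `iter + 1 ≤ K`. -/
theorem count_le (h : Inv sample l R c D σ) (v : I.V) :
    (σ.popped.filter fun b => I.EndsAt v b).length ≤ I.K := by
  have h₁ := h.count v
  have h₂ := σ.iter.2
  split_ifs at h₁ <;> omega

theorem Q_nodup (h : Inv sample l R c D σ) (v : I.V) : (σ.Q v).Nodup := by
  refine List.Nodup.filter _ (h.queue_nodup.append h.optimalPaths_nodup fun b hb hb' => ?_)
  exact h.disjoint b hb (h.optimalPaths_subset b hb')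

theorem mem_undominated (h : Inv sample l R c D σ) {v : I.V} {b : List I.V}
    (hb : b ∈ σ.queue ∨ b ∈ σ.popped) (hv : I.EndsAt v b) : b ∈ undominated sample v :=
  ⟨⟨h.isPath b hb, hv⟩, h.not_dominates b hb v hv⟩

theorem mem_undominated_of_mem_Q (h : Inv sample l R c D σ) {v : I.V} {b : List I.V}
    (hb : b ∈ σ.Q v) : b ∈ undominated sample v :=
  have hb := mem_Q.1 hb
  h.mem_undominated (hb.1.imp_right (h.optimalPaths_subset b)) hb.2

theorem length_queue_append_popped_le (h : Inv sample l R c D σ) {v : I.V} {n : ℕ}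
    (hn : (undominated sample v).encard ≤ n) :
    ((σ.queue ++ σ.popped).filter fun b => I.EndsAt v b).length ≤ n := by
  refine List.Nodup.length_le_of_encard_le
    ((h.queue_nodup.append h.popped_nodup fun b => h.disjoint b).filter _) (fun b hb => ?_) hn
  simp only [List.mem_filter, List.mem_append, decide_eq_true_eq] at hb
  exact h.mem_undominated hb.1 hb.2

/-- The queued paths to `v` belong to `Q_v`, so there are at most `K + 1` of them; with at most `K`
popped ones this gives `2K + 1 ≤ 3K`. -/
theorem length_queue_append_popped_le' (h : Inv sample l R c D σ) (v : I.V) :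
    ((σ.queue ++ σ.popped).filter fun b => I.EndsAt v b).length ≤ 3 * I.K := by
  have h₁ := h.count_le v
  have h₂ := h.length_Q v
  have := I.K_pos
  simp only [Q, List.filter_append, List.length_append] at h₁ h₂ ⊢
  omega

theorem length_Q_le (h : Inv sample l R c D σ) {v : I.V} {n : ℕ}
    (hn : (undominated sample v).encard ≤ n) : (σ.Q v).length ≤ n :=
  (h.Q_nodup v).length_le_of_encard_le (fun _ => h.mem_undominated_of_mem_Q) hn

/-- Paths in the heap are determined by their end nodes. -/
theorem heap_card_le (h : Inv sample l R c D σ) : σ.heap.card ≤ Fintype.card I.V := by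
  rw [← Finset.card_univ]
  refine Finset.card_le_card_of_injOn (fun b => b.headD I.s) (fun _ _ => Finset.mem_univ _) ?_
  intro b hb b' hb' hbb'
  refine h.heap_inj b hb b' hb' ?_
  obtain ⟨v, hv⟩ := (h.isPath b (.inl (h.heap_subset b hb))).exists_endsAt
  obtain ⟨v', hv'⟩ := (h.isPath b' (.inl (h.heap_subset b' hb'))).exists_endsAt
  simp only [EndsAt] at hv hv'
  simp only [List.headD_eq_head?_getD, hv, hv', Option.getD_some] at hbb'
  rw [hv, hv', hbb']

theorem heap_filter_card_le_one (h : Inv sample l R c D σ) {v : I.V} {P : List I.V → Prop}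
    (hP : ∀ b, P b → I.EndsAt v b) : (σ.heap.filter P).card ≤ 1 := by
  refine Finset.card_le_one.2 fun b hb b' hb' => ?_
  rw [Finset.mem_filter] at hb hb'
  exact h.heap_inj b hb.1 b' hb'.1 ((hP b hb.2).trans (hP b' hb'.2).symm)

end Inv

end State

/-! ### The time of an execution -/

/-- A bound on the time of deleting an entry of the Priority Heap. -/
noncomputable def heapTime (I : MOWSP) : ℕ := 1 + Nat.log 2 (Fintype.card I.V)

/-- A bound on the time of initializing one list `best_v`. -/
def initBestTime (I : MOWSP) : ℕ := 6 * I.W * I.K ^ 2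

/-- A bound on the time of a scan at `v` after a negative test against `pareto_sample`, where `n`
bounds the number of undominated paths to an `l`-node. -/
noncomputable def passTime (I : MOWSP) (l n : ℕ) (v : I.V) : ℕ :=
  40 * I.W * ((if v ∈ I.lNodes l then n else I.K) + I.heapTime)

/-- A bound on the time of scanning the path `q` to `v`, without the initialization of `best_v`. -/
noncomputable def scanBound (sample : I.V → List I.V) (l n : ℕ) (v : I.V) (q : List I.V) : ℕ :=
  State.preTime I + if I.Dominates (sample v) q then 0 else I.passTime l n v

namespace State

/-- The number of nodes `v` for which `best_v` has been initialized. -/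
noncomputable def numBest (σ : State I) : ℕ := (Finset.univ.filter fun v => σ.best v ≠ none).card

theorem numBest_mono {σ τ : State I} (h : ∀ u, σ.best u ≠ none → τ.best u ≠ none) :
    σ.numBest ≤ τ.numBest :=
  Finset.card_le_card fun u hu => by simpa using h u (by simpa using hu)

theorem numBest_lt {σ τ : State I} (h : ∀ u, σ.best u ≠ none → τ.best u ≠ none) {v : I.V}
    (hσ : σ.best v = none) (hτ : τ.best v ≠ none) : σ.numBest + 1 ≤ τ.numBest :=
  Finset.card_lt_card <| (Finset.ssubset_iff_of_subset fun u hu => by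
    simpa using h u (by simpa using hu)).2 ⟨v, by simpa using hτ, by simp [hσ]⟩

theorem TestsDominance.length_lt {σ : State I} {v : I.V} (h : σ.TestsDominance v) :
    (σ.Q v).length < I.K := by
  have hW : (1 : ℝ) ≤ I.W := by exact_mod_cast I.W_pos
  have : ((σ.Q v).length : ℝ) < I.K := lt_of_lt_of_le h (div_le_self (by positivity) hW)
  exact_mod_cast this

/-- Common arithmetic of all relevance checks: `M` is `n` or `K`, `q` is `|Q_v|`, `m` counts queued
and popped paths, `r` and `s` are removal and push times, and `x`, `y` cover the work on `best_v`.
Since `M` may be `0`, additive constants are absorbed by `h ≥ 1`. -/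
theorem passTime_aux {W m M h q r s x y : ℕ} (hW : 1 ≤ W) (hh : 1 ≤ h) (hq : q ≤ 2 * M)
    (hr : r ≤ q + h) (hs : s ≤ 1 + 2 * W + m * (2 * W + 1) + q + h + 1) (hm : m ≤ 3 * M)
    (hx : x ≤ 8 * (W * M)) (hy : y ≤ 5 * M) :
    1 + x + y + r + 2 * (q * (2 * W)) + s ≤ 40 * W * (M + h) := by
  have h₁ : q * (2 * W) ≤ 2 * M * (2 * W) := Nat.mul_le_mul_right _ hq
  have h₂ : m * (2 * W + 1) ≤ 3 * M * (2 * W + 1) := Nat.mul_le_mul_right _ hm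
  have h₃ : M ≤ W * M := Nat.le_mul_of_pos_left _ hW
  have h₄ : h ≤ W * h := Nat.le_mul_of_pos_left _ hW
  have h₅ : W ≤ W * h := Nat.le_mul_of_pos_right _ hh
  nlinarith

theorem one_le_heapTime (I : MOWSP) : 1 ≤ I.heapTime := Nat.le_add_right _ _

/-! ### Amortized time of a scan -/

namespace Inv

variable {sample : I.V → List I.V} {l n : ℕ} {R : Set (List I.V)} {c : ℝ} {D : Set I.V}
  {σ σ' : State I} {v : I.V} {q : List I.V} {t : ℕ}

theorem heapDeleteTime_le (h : Inv sample l R c D σ) : σ.heapDeleteTime ≤ I.heapTime :=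
  Nat.add_le_add_left (Nat.log_mono_right h.heap_card_le) 1

theorem removeTime_le (h : Inv sample l R c D σ) {P : List I.V → Prop}
    (hP : ∀ b, P b → I.EndsAt v b) : σ.removeTime v P ≤ (σ.Q v).length + I.heapTime := by
  refine Nat.add_le_add (List.length_filter_le _ _) ?_
  simpa using Nat.mul_le_mul (h.heap_filter_card_le_one hP) h.heapDeleteTime_le

theorem pushTime_le (h : Inv sample l R c D σ) {m k : ℕ}
    (hm : ((σ.queue ++ σ.popped).filter fun b => I.EndsAt v b).length ≤ m)
    (hk : (σ.Q v).length ≤ k) :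
    σ.pushTime v q ≤ 1 + 2 * I.W + m * (2 * I.W + 1) + k + I.heapTime + 1 := by
  have h₁ := Nat.mul_le_mul_right (2 * I.W + 1) hm
  have h₂ := Nat.mul_le_mul (h.heap_filter_card_le_one (P := fun b => I.EndsAt v b)
    fun _ hb => hb) h.heapDeleteTime_le
  unfold pushTime costTime
  split_ifs
  · omega
  · omega

/-- The fresh path `q` together with `Q_v` forms a set of distinct undominated paths, whence the
strict inequality `|Q_v| < n`. -/
theorem testsDominance (h : Inv sample l R c D σ)
    (hn : ∀ v ∈ I.lNodes l, (undominated sample v).encard ≤ n)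
    (hnK : (n : ℝ) ≤ (I.K : ℝ) / (I.W : ℝ)) (hqR : q ∉ R) (hq : I.IsPath q) (hv : I.EndsAt v q)
    (hs : ¬ I.Dominates (sample v) q) (hl : v ∈ I.lNodes l) : σ.TestsDominance v := by
  have hqQ : q ∉ σ.Q v := fun hm => hqR <| h.mem_seen q <|
    (mem_Q.1 hm).1.imp_right (h.optimalPaths_subset q)
  have : (q :: σ.Q v).length ≤ n := by
    refine List.Nodup.length_le_of_encard_le (List.nodup_cons.2 ⟨hqQ, h.Q_nodup v⟩) ?_ (hn v hl)
    intro b hb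
    rcases List.mem_cons.1 hb with rfl | hb
    · exact ⟨⟨hq, hv⟩, hs⟩
    · exact h.mem_undominated_of_mem_Q hb
  refine lt_of_lt_of_le ?_ hnK
  exact_mod_cast this

/-- The bound `M` on the sizes of the lists at `v` that enters `passTime`. -/
theorem sizes (h : Inv sample l R c D σ)
    (hn : ∀ v ∈ I.lNodes l, (undominated sample v).encard ≤ n) (v : I.V) :
    (σ.Q v).length ≤ 2 * (if v ∈ I.lNodes l then n else I.K) ∧
      ((σ.queue ++ σ.popped).filter fun b => I.EndsAt v b).length ≤
        3 * (if v ∈ I.lNodes l then n else I.K) := by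
  split_ifs with hl
  · have h₁ := h.length_Q_le (hn v hl)
    have h₂ := h.length_queue_append_popped_le (hn v hl)
    omega
  · have h₁ := h.length_Q v
    have h₂ := h.length_queue_append_popped_le' v
    have := I.K_pos
    omega

/-- At an `l`-node no list `best_v` has to be maintained, so the bound can be in terms of `n`;
elsewhere that maintenance costs `O(W K)`, which fits the bound with `K`. -/
theorem scan_dominance_time (h : Inv sample l R c D σ)
    (hn : ∀ v ∈ I.lNodes l, (undominated sample v).encard ≤ n) {σ₁ : State I}
    (h₁ : Inv sample l R c D σ₁) (hQ₁ : (σ₁.Q v).length ≤ (σ.Q v).length)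
    {P : List I.V → Prop} (hP : ∀ b, P b → I.EndsAt v b) :
    1 + 2 * ((σ.Q v).length * I.dominanceTime) + σ.removeTime v P
      + (if σ.best v = none then 0 else improveTime I) + σ₁.pushTime v q ≤ I.passTime l n v := by
  obtain ⟨hq, hm⟩ := h.sizes hn v
  have hm₁ := (h₁.sizes hn v).2
  have hx : (if σ.best v = none then 0 else improveTime I) ≤
      8 * (I.W * (if v ∈ I.lNodes l then n else I.K)) := by
    by_cases hl : v ∈ I.lNodes l
    · simp [h.best_none v hl]
    · have := I.W_pos
      simp only [hl, if_false, improveTime, costTime]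
      split_ifs
      · omega
      · nlinarith [Nat.mul_le_mul_right I.K this]
  have := passTime_aux I.W_pos (one_le_heapTime I) hq (h.removeTime_le hP)
    (h₁.pushTime_le (q := q) le_rfl hQ₁) hm₁ hx (Nat.zero_le _)
  unfold passTime dominanceTime
  omega

theorem scan_best_time (h : Inv sample l R c D σ) {σ₁ : State I}
    (h₁ : Inv sample l R c D σ₁) (hQ₁ : (σ₁.Q v).length ≤ (σ.Q v).length)
    {P : List I.V → Prop} (hP : ∀ b, P b → I.EndsAt v b) (hl : v ∉ I.lNodes l) :
    1 + I.K + improveTime I + I.K + (I.K + (σ.Q v).length) + σ.removeTime v P + σ₁.pushTime v q ≤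
      I.passTime l n v := by
  have hK := I.K_pos
  have hW := I.W_pos
  have hq : (σ.Q v).length ≤ 2 * I.K := by have := h.length_Q v; omega
  have hx : improveTime I ≤ 8 * (I.W * I.K) := by
    simp only [improveTime, costTime]
    nlinarith [Nat.mul_le_mul_right I.K hW]
  have := passTime_aux hW (one_le_heapTime I) hq (h.removeTime_le hP)
    (h₁.pushTime_le (q := q) le_rfl hQ₁) (h₁.length_queue_append_popped_le' v) hx
    (show I.K + I.K + (I.K + (σ.Q v).length) ≤ 5 * I.K by omega)
  simp only [passTime, hl, if_false]
  omega

/-- Potential argument with `numBest`: a first use of `best_v` raises the potential by at least one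
and is paid by it, while later uses cost `K`. The constant in `initBestTime` comes from `|Q_v| ≤ 2K`
and `2W + 1 ≤ 3W`. -/
theorem bestTime_le (h : Inv sample l R c D σ)
    (hmono : ∀ u, σ.best u ≠ none → σ'.best u ≠ none) (hv : σ'.best v ≠ none) :
    σ.bestTime v + I.initBestTime * σ.numBest ≤ I.K + I.initBestTime * σ'.numBest := by
  unfold bestTime
  split_ifs with hb
  · have h₁ := Nat.mul_le_mul_left I.initBestTime (numBest_lt hmono hb hv)
    have hK := I.K_pos
    have hW := I.W_pos
    have hq : (σ.Q v).length ≤ 2 * I.K := by have := h.length_Q v; omega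
    have h₂ : (σ.Q v).length * I.K * (I.costTime + 1) ≤ 2 * I.K * I.K * (3 * I.W) :=
      Nat.mul_le_mul (Nat.mul_le_mul_right _ hq) (by unfold costTime; omega)
    have h₃ : 2 * I.K * I.K * (3 * I.W) = I.initBestTime := by unfold initBestTime; ring
    rw [mul_add] at h₁
    omega
  · have := Nat.mul_le_mul_left I.initBestTime (numBest_mono hmono)
    omega

/-- The bound `scanBound` depends only on the path, not on the state, so that after summation the
scans can be counted without following the execution. -/
theorem scan (h : Inv sample l R c D σ)
    (hn : ∀ v ∈ I.lNodes l, (undominated sample v).encard ≤ n)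
    (hnK : (n : ℝ) ≤ (I.K : ℝ) / (I.W : ℝ)) (hqR : q ∉ R) (hq : I.IsPath q) (hv : I.EndsAt v q)
    (hc : c ≤ I.cost σ.iter q) (hscan : Scan sample σ v q t σ') :
    Inv sample l (insert q R) c D σ' ∧ σ'.iter = σ.iter ∧ σ'.popped = σ.popped ∧
      t + I.initBestTime * σ.numBest ≤ scanBound sample l n v q + I.initBestTime * σ'.numBest := by
  have hsub : R ⊆ insert q R := Set.subset_insert q R
  cases hscan with
  | dominatedBySample hs => exact ⟨h.mono hsub, rfl, rfl, by simp [scanBound]⟩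
  | dominated hs hQ hd =>
    refine ⟨h.mono hsub, rfl, rfl, ?_⟩
    -- The actual time is only part of the sum bounded here; the removal and push terms, and the
    -- choice of `P`, are slack.
    have := h.scan_dominance_time (q := q) (P := fun b => I.EndsAt v b) hn h le_rfl fun _ hb => hb
    simp only [scanBound, hs, if_false]
    omega
  | nonDominated hs hQ hd σ₁ hσ₁ =>
    have h₁ : Inv sample l R c D σ₁ := by
      rw [hσ₁]
      exact (h.remove _).setBest v _ fun hl => by simp [h.best_none v hl]
    have hQ₁ : (σ₁.Q v).length ≤ (σ.Q v).length := by
      rw [hσ₁, Q_setBest, Q_remove]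
      exact List.length_filter_le _ _
    have hiter : σ₁.iter = σ.iter := by rw [hσ₁]; rfl
    refine ⟨h₁.push hqR hq hv hs (hiter ▸ hc) (hQ₁.trans hQ.length_lt.le), ?_, ?_, ?_⟩
    · rw [push_iter, hiter]
    · rw [push_popped, hσ₁]; rfl
    · have hb : σ.numBest ≤ (σ₁.push v q).numBest := numBest_mono fun u hu => by
        rw [push_best, hσ₁]
        by_cases huv : u = v
        · subst huv; simpa [State.setBest] using hu
        · simpa [State.setBest, State.remove, huv] using hu
      have hb := Nat.mul_le_mul_left I.initBestTime hb
      have := h.scan_dominance_time (q := q) (P := fun b => I.EndsAt v b ∧ I.Dominates q b) hn h₁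
        hQ₁ fun _ hb => hb.1
      simp only [scanBound, hs, if_false]
      omega
  | notBetter hs hQ β hβ hb =>
    have hl : v ∉ I.lNodes l := fun hl => hQ (h.testsDominance hn hnK hqR hq hv hs hl)
    refine ⟨(h.mono hsub).setBest v _ fun hl' => absurd hl' hl, rfl, rfl, ?_⟩
    have h₁ := h.bestTime_le (σ' := σ.setBest v (some β)) (v := v) (fun u hu => by
        by_cases huv : u = v
        · subst huv; simp [State.setBest]
        · simpa [State.setBest, huv] using hu) (by simp [State.setBest])
    have := h.scan_best_time (n := n) (q := q) (P := fun b => I.EndsAt v b) h le_rfl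
      (fun _ hb => hb) hl
    simp only [scanBound, hs, if_false]
    omega
  | better hs hQ β hβ hb σ₁ hσ₁ =>
    have hl : v ∉ I.lNodes l := fun hl => hQ (h.testsDominance hn hnK hqR hq hv hs hl)
    have h₁ : Inv sample l R c D σ₁ := by
      rw [hσ₁]
      exact (h.remove _).setBest v _ fun hl' => absurd hl' hl
    have hQe : σ₁.Q v =
        (σ.Q v).filter fun b => ¬ (I.EndsAt v b ∧ b ∉ Set.range (improve β q)) := by
      rw [hσ₁, Q_setBest, Q_remove]
      exact List.filter_congr fun b _ => decide_eq_decide.2 Iff.rfl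
    have hQ₁ : (σ₁.Q v).length ≤ (σ.Q v).length := hQe ▸ List.length_filter_le _ _
    -- All survivors are values of the updated list, which has only `K` entries.
    have hQK : (σ₁.Q v).length ≤ I.K := by
      rw [← List.toFinset_card_of_nodup (h₁.Q_nodup v)]
      refine (Finset.card_le_card (t := Finset.univ.image (improve β q)) fun b hb => ?_).trans
        (Finset.card_image_le.trans (by simp))
      rw [List.mem_toFinset, hQe, List.mem_filter] at hb
      have h₂ := hb.2
      simp only [decide_eq_true_eq, not_and, not_not] at h₂
      simpa using h₂ (mem_Q.1 hb.1).2
    have hiter : σ₁.iter = σ.iter := by rw [hσ₁]; rfl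
    refine ⟨h₁.push hqR hq hv hs (hiter ▸ hc) hQK, ?_, ?_, ?_⟩
    · rw [push_iter, hiter]
    · rw [push_popped, hσ₁]; rfl
    · have h₂ := h.bestTime_le (σ' := σ₁.push v q) (v := v) (fun u hu => by
          rw [push_best, hσ₁]
          by_cases huv : u = v
          · subst huv; simp [State.setBest]
          · simpa [State.setBest, State.remove, huv] using hu) (by rw [push_best, hσ₁]; simp [State.setBest])
      have := h.scan_best_time (n := n) (q := q)
        (P := fun b => I.EndsAt v b ∧ b ∉ Set.range (improve β q)) h₁ hQ₁ (fun _ hb => hb.1) hl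
      simp only [scanBound, hs, if_false]
      omega

theorem scanList (hn : ∀ v ∈ I.lNodes l, (undominated sample v).encard ≤ n)
    (hnK : (n : ℝ) ≤ (I.K : ℝ) / (I.W : ℝ)) {p : List I.V} {w : I.V} (hp : I.IsPath p)
    (hw : I.EndsAt w p) {ns : List I.V} (hscan : ScanList sample p σ ns t σ') :
    ∀ {R : Set (List I.V)}, Inv sample l R c D σ → ns.Nodup → (∀ u ∈ ns, (w, u) ∈ I.E) →
      (∀ u ∈ ns, u :: p ∉ R) → c ≤ I.cost σ.iter p →
      Inv sample l (R ∪ {b | ∃ u ∈ ns, b = u :: p}) c D σ' ∧ σ'.iter = σ.iter ∧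
        σ'.popped = σ.popped ∧
        t + I.initBestTime * σ.numBest ≤
          (ns.map fun u => scanBound sample l n u (u :: p)).sum + I.initBestTime * σ'.numBest := by
  induction hscan with
  | nil σ => exact fun h _ _ _ _ => ⟨h.mono Set.subset_union_left, rfl, rfl, by simp⟩
  | @cons σ σ₁ σ₂ u ns t₁ t₂ h₁ h₂ ih =>
    intro R h hnd hE hR hc
    obtain ⟨hu, hnd⟩ := List.nodup_cons.1 hnd
    have hEu := hE u List.mem_cons_self
    obtain ⟨i₁, e₁, p₁, s₁⟩ := h.scan hn hnK (hR u List.mem_cons_self) (isPath_cons hp hw hEu) rfl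
      (hc.trans (cost_le_cost_cons _ hw hEu)) h₁
    obtain ⟨i₂, e₂, p₂, s₂⟩ := ih i₁ hnd (fun x hx => hE x (List.mem_cons_of_mem _ hx))
      -- Extensions by distinct nodes are distinct paths, so the remaining ones stay fresh.
      (fun x hx => by
        rintro (hm | hm)
        · exact hu ((List.cons.inj hm).1 ▸ hx)
        · exact hR x (List.mem_cons_of_mem _ hx) hm) (by rw [e₁]; exact hc)
    refine ⟨i₂.mono ?_, e₂.trans e₁, p₂.trans p₁, ?_⟩
    · rintro b ((rfl | hb) | ⟨x, hx, rfl⟩)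
      · exact .inr ⟨u, List.mem_cons_self, rfl⟩
      · exact .inl hb
      · exact .inr ⟨x, List.mem_cons_of_mem _ hx, rfl⟩
    · simp only [List.map_cons, List.sum_cons]
      omega

end Inv

end State

/-- The bound on the time of scanning the extensions of a path. -/
noncomputable def developBound (sample : I.V → List I.V) (l n : ℕ) (p : List I.V) : ℕ :=
  ∑ e ∈ I.E.filter fun e => I.EndsAt e.1 p, scanBound sample l n e.2 (e.2 :: p)

theorem sum_map_eq_developBound (sample : I.V → List I.V) (l n : ℕ) {p : List I.V} {v : I.V}
    (hv : I.EndsAt v p) {ns : List I.V} (hnd : ns.Nodup) (hns : ∀ u, u ∈ ns ↔ (v, u) ∈ I.E) :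
    (ns.map fun u => scanBound sample l n u (u :: p)).sum = developBound sample l n p := by
  rw [← List.sum_toFinset _ hnd]
  refine Finset.sum_bij (fun u _ => (v, u)) (fun u hu => ?_) (fun _ _ _ _ h => (Prod.mk.inj h).2)
    (fun e he => ?_) fun _ _ => rfl
  · exact Finset.mem_filter.2 ⟨(hns u).1 (List.mem_toFinset.1 hu), hv⟩
  · obtain ⟨he, hp⟩ := Finset.mem_filter.1 he
    obtain rfl := hp.unique hv
    exact ⟨e.2, List.mem_toFinset.2 ((hns _).2 he), rfl⟩

/-- The paths created until the paths of the list `ps` have been developed. -/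
def created (I : MOWSP) (ps : List (List I.V)) : Set (List I.V) :=
  {b | b = [I.s] ∨ ∃ u, ∃ p ∈ ps, b = u :: p}

/-- With `R` the set of created paths, freshness of an extension reduces to its parent not having
been popped before, which is the disjointness of `queue` and `popped`. -/
theorem Exec.exists_inv {sample : I.V → List I.V} {l n t : ℕ} {σ : State I}
    (hs : I.IsParetoSample sample)
    (hn : ∀ v ∈ I.lNodes l, (undominated sample v).encard ≤ n)
    (hnK : (n : ℝ) ≤ (I.K : ℝ) / (I.W : ℝ)) (h : Exec I sample t σ) :
    (∃ c D, State.Inv sample l (I.created σ.popped) c D σ) ∧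
      t ≤ (σ.popped.map (developBound sample l n)).sum + I.initBestTime * σ.numBest := by
  induction h with
  | init _ =>
    exact ⟨⟨0, ∅, (State.Inv.init hs l).mono fun b hb => .inl hb⟩, Nat.zero_le _⟩
  | adapt _ _ hlt ih =>
    obtain ⟨⟨c, D, i⟩, ht⟩ := ih
    obtain ⟨c', i'⟩ := i.adapt hlt
    exact ⟨⟨c', ∅, i'⟩, ht⟩
  | @develop t t' σ σ' _ p hp hmin v hv ns hnd hns hscan ih =>
    obtain ⟨⟨c, D, i⟩, ht⟩ := ih
    have hpq := i.heap_subset p hp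
    have hpath := i.isPath p (.inl hpq)
    obtain ⟨i', -, hpop, ht'⟩ := State.Inv.scanList hn hnK hpath hv hscan (i.pop hp hmin hv) hnd
      (fun u hu => (hns u).1 hu) (fun u _ => by
        rintro (h₁ | ⟨x, p', hp', h₁⟩)
        · obtain rfl : p = [] := (List.cons.inj h₁).2
          exact hpath
        · obtain rfl := (List.cons.inj h₁).2
          exact i.disjoint p hpq hp') le_rfl
    have hpop : σ'.popped = σ.popped ++ [p] := hpop
    refine ⟨⟨_, _, i'.mono ?_⟩, ?_⟩
    · rw [hpop]
      rintro b ((rfl | ⟨u, p', hp', rfl⟩) | ⟨u, -, rfl⟩)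
      · exact .inl rfl
      · exact .inr ⟨u, p', by simp [hp'], rfl⟩
      · exact .inr ⟨u, p, by simp, rfl⟩
    · rw [sum_map_eq_developBound sample l n hv hnd hns] at ht'
      have hb : (σ.pop p).numBest = σ.numBest := rfl
      rw [hb] at ht'
      rw [hpop, List.map_append, List.sum_append, List.map_singleton, List.sum_singleton]
      omega

/-! ### Counting the scans -/

/-- The number of nodes that are not `l`-nodes. -/
noncomputable def numNonLNodes (I : MOWSP) (l : ℕ) : ℕ :=
  (Finset.univ.filter fun v => v ∉ I.lNodes l).card

theorem card_filter_fst_le (I : MOWSP) (l : ℕ) :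
    (I.E.filter fun e => e.1 ∉ I.lNodes l).card ≤ I.maxOutDegree * I.numNonLNodes l := by
  refine Finset.card_le_mul_card_image_of_maps_to (f := Prod.fst)
    (fun e he => by simpa using (Finset.mem_filter.1 he).2) _ fun v _ => ?_
  refine (Finset.card_le_card ?_).trans (Finset.le_sup (f := fun v : I.V =>
    (I.E.filter fun e => e.1 = v).card) (Finset.mem_univ v))
  exact Finset.filter_subset_filter _ (Finset.filter_subset _ _)

theorem card_filter_snd_le (I : MOWSP) (l : ℕ) :
    (I.E.filter fun e => e.2 ∉ I.lNodes l).card ≤ I.maxInDegree * I.numNonLNodes l := by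
  refine Finset.card_le_mul_card_image_of_maps_to (f := Prod.snd)
    (fun e he => by simpa using (Finset.mem_filter.1 he).2) _ fun v _ => ?_
  refine (Finset.card_le_card ?_).trans (Finset.le_sup (f := fun v : I.V =>
    (I.E.filter fun e => e.2 = v).card) (Finset.mem_univ v))
  exact Finset.filter_subset_filter _ (Finset.filter_subset _ _)

/-- The pairs of a path of `P` and an edge that extends it. -/
noncomputable def extensions (I : MOWSP) (P : Finset (List I.V)) :
    Finset (List I.V × (I.V × I.V)) :=
  (P ×ˢ I.E).filter fun x => I.EndsAt x.2.1 x.1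

theorem mem_extensions {P : Finset (List I.V)} {x : List I.V × (I.V × I.V)} :
    x ∈ I.extensions P ↔ (x.1 ∈ P ∧ x.2 ∈ I.E) ∧ I.EndsAt x.2.1 x.1 := by
  simp [extensions]

theorem sum_developBound (sample : I.V → List I.V) (l n : ℕ) (P : Finset (List I.V)) :
    ∑ p ∈ P, developBound sample l n p =
      ∑ x ∈ I.extensions P, scanBound sample l n x.2.2 (x.2.2 :: x.1) := by
  simp only [developBound, extensions, Finset.sum_filter, Finset.sum_product]

/-- An edge extends only paths ending at its tail, so `k` bounds each fibre of the projection to the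
edge. -/
theorem card_extensions_filter_le {P : Finset (List I.V)} {p : I.V × I.V → Prop}
    [DecidablePred p] {k : ℕ}
    (hP : ∀ e ∈ I.E, p e → (P.filter fun b => I.EndsAt e.1 b).card ≤ k) :
    ((I.extensions P).filter fun x => p x.2).card ≤ k * (I.E.filter p).card := by
  refine Finset.card_le_mul_card_image_of_maps_to (f := Prod.snd) (fun x hx => ?_) _
    fun e he => ?_
  · obtain ⟨hx, hp⟩ := Finset.mem_filter.1 hx
    exact Finset.mem_filter.2 ⟨(mem_extensions.1 hx).1.2, hp⟩
  · obtain ⟨he, hp⟩ := Finset.mem_filter.1 he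
    refine (Finset.card_le_card_of_injOn Prod.fst (fun x hx => ?_) ?_).trans (hP e he hp)
    · obtain ⟨hx₁, rfl⟩ := Finset.mem_filter.1 hx
      obtain ⟨hx, h⟩ := mem_extensions.1 (Finset.mem_filter.1 hx₁).1
      exact Finset.mem_filter.2 ⟨hx.1, h⟩
    · intro x hx y hy hxy
      exact Prod.ext hxy ((Finset.mem_filter.1 hx).2.trans (Finset.mem_filter.1 hy).2.symm)

/-- The extended path determines both its parent and its last edge, so the pairs over a fixed
`l`-node inject into the undominated paths to it. Counting by nodes rather than edges gives `n |V|`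
instead of `n |E|`. -/
theorem card_extensions_undominated_le {sample : I.V → List I.V} {l n : ℕ}
    (hn : ∀ v ∈ I.lNodes l, (undominated sample v).encard ≤ n) {P : Finset (List I.V)}
    (hP : ∀ p ∈ P, I.IsPath p) :
    ((I.extensions P).filter fun x => x.2.2 ∈ I.lNodes l ∧
      ¬ I.Dominates (sample x.2.2) (x.2.2 :: x.1)).card ≤ n * Fintype.card I.V := by
  rw [← Finset.card_univ]
  refine Finset.card_le_mul_card_image_of_maps_to (f := fun x => x.2.2)
    (fun _ _ => Finset.mem_univ _) _ fun v _ => ?_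
  by_cases hv : v ∈ I.lNodes l
  · rw [← Finset.card_image_of_injOn (f := fun x : List I.V × (I.V × I.V) => x.2.2 :: x.1)]
    · refine Finset.card_le_of_encard_le (fun q hq => ?_) (hn v hv)
      obtain ⟨x, hx, rfl⟩ := Finset.mem_image.1 hq
      obtain ⟨hx₁, rfl⟩ := Finset.mem_filter.1 hx
      obtain ⟨hx₂, -, hd⟩ := Finset.mem_filter.1 hx₁
      obtain ⟨⟨h₁, h₂⟩, h₃⟩ := mem_extensions.1 hx₂
      exact ⟨⟨isPath_cons (hP _ h₁) h₃ h₂, rfl⟩, hd⟩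
    · intro x hx y hy hxy
      have hx := (mem_extensions.1 (Finset.mem_filter.1 (Finset.mem_filter.1 hx).1).1).2
      have hy := (mem_extensions.1 (Finset.mem_filter.1 (Finset.mem_filter.1 hy).1).1).2
      obtain ⟨h₁, h₂⟩ := List.cons.inj hxy
      rw [← h₂] at hy
      exact Prod.ext h₂ (Prod.ext (hx.unique hy) h₁)
  · rw [Finset.card_eq_zero.2]
    · exact Nat.zero_le _
    · refine Finset.filter_eq_empty_iff.2 fun x hx hxv => hv ?_
      exact hxv ▸ (Finset.mem_filter.1 hx).2.1

theorem sum_scanBound_le (sample : I.V → List I.V) (l n : ℕ)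
    (Z : Finset (List I.V × (I.V × I.V))) :
    ∑ x ∈ Z, scanBound sample l n x.2.2 (x.2.2 :: x.1) ≤
      Z.card * (1 + 3 * I.W) +
      (Z.filter fun x => x.2.2 ∈ I.lNodes l ∧
        ¬ I.Dominates (sample x.2.2) (x.2.2 :: x.1)).card * (40 * I.W * (n + I.heapTime)) +
      (Z.filter fun x => x.2.2 ∉ I.lNodes l).card * (40 * I.W * (I.K + I.heapTime)) := by
  simp only [← smul_eq_mul, ← Finset.sum_const, Finset.sum_filter, ← Finset.sum_add_distrib]
  refine Finset.sum_le_sum fun x _ => ?_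
  simp only [scanBound, passTime, State.preTime, dominanceTime, smul_eq_mul]
  split_ifs <;> first | omega | tauto

/-- Extensions are counted by the tail of the last edge for the cost every scan incurs, and by its
head for the cost of passing the sample test. -/
theorem Exec.time_le {sample : I.V → List I.V} {l n t : ℕ} {σ : State I}
    (hs : I.IsParetoSample sample)
    (hn : ∀ v ∈ I.lNodes l, (undominated sample v).encard ≤ n)
    (hnK : (n : ℝ) ≤ (I.K : ℝ) / (I.W : ℝ)) (h : Exec I sample t σ) :
    t ≤ (n * I.E.card + I.K * (I.maxOutDegree * I.numNonLNodes l)) * (1 + 3 * I.W) +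
      n * Fintype.card I.V * (40 * I.W * (n + I.heapTime)) +
      I.K * (I.maxInDegree * I.numNonLNodes l) * (40 * I.W * (I.K + I.heapTime)) +
      I.initBestTime * I.numNonLNodes l := by
  obtain ⟨⟨c, D, i⟩, ht⟩ := h.exists_inv hs hn hnK
  set P := σ.popped.toFinset with hPdef
  have hmem : ∀ b, b ∈ P ↔ b ∈ σ.popped := fun b => List.mem_toFinset
  have hK : ∀ v, (P.filter fun b => I.EndsAt v b).card ≤ I.K := fun v => by
    refine (Finset.card_le_card (t := (σ.popped.filter fun b => I.EndsAt v b).toFinset)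
      fun b hb => ?_).trans ((List.toFinset_card_le _).trans (i.count_le v))
    simpa [hPdef] using hb
  have hN : ∀ v ∈ I.lNodes l, (P.filter fun b => I.EndsAt v b).card ≤ n := fun v hv =>
    Finset.card_le_of_encard_le (fun b hb => i.mem_undominated
      (.inr ((hmem b).1 (Finset.mem_filter.1 hb).1)) (Finset.mem_filter.1 hb).2) (hn v hv)
  have h₁ : (I.extensions P).card ≤
      n * I.E.card + I.K * (I.maxOutDegree * I.numNonLNodes l) := by
    rw [← Finset.card_filter_add_card_filter_not (s := I.extensions P)
      (fun x => x.2.1 ∈ I.lNodes l)]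
    refine Nat.add_le_add ?_ ?_
    · exact (card_extensions_filter_le (p := fun e => e.1 ∈ I.lNodes l)
        fun e _ he => hN _ he).trans (Nat.mul_le_mul_left _ (Finset.card_filter_le _ _))
    · exact (card_extensions_filter_le (p := fun e => e.1 ∉ I.lNodes l)
        fun e _ _ => hK _).trans (Nat.mul_le_mul_left _ (I.card_filter_fst_le l))
  have h₂ := card_extensions_undominated_le hn (P := P)
    fun p hp => i.isPath p (.inr ((hmem p).1 hp))
  have h₃ := (card_extensions_filter_le (p := fun e => e.2 ∉ I.lNodes l)
    fun e _ _ => hK e.1).trans (Nat.mul_le_mul_left _ (I.card_filter_snd_le l))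
  have h₄ : σ.numBest ≤ I.numNonLNodes l := Finset.card_le_card fun v hv => by
    simp only [Finset.mem_filter, Finset.mem_univ, true_and] at hv ⊢
    exact fun hl => hv (i.best_none v hl)
  rw [← List.sum_toFinset _ i.popped_nodup, sum_developBound] at ht
  refine (ht.trans (Nat.add_le_add_right (sum_scanBound_le _ _ _ _) _)).trans ?_
  gcongr

theorem numNonLNodes_le {b : ℝ} {l : ℕ} (h : I.IsL b l) :
    (I.numNonLNodes l : ℝ) ≤ Real.logb b (Fintype.card I.V) := by
  have hV : (0 : ℝ) < Fintype.card I.V := by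
    exact_mod_cast Fintype.card_pos_iff.2 ⟨I.s⟩
  have h₁ : I.alpha l ≥ _ := h.1
  have h₂ : (I.lNodes l).card + I.numNonLNodes l = Fintype.card I.V := by
    rw [numNonLNodes, ← Finset.card_univ,
      ← Finset.card_filter_add_card_filter_not (s := Finset.univ) (fun v => v ∈ I.lNodes l)]
    simp
  have h₃ : ((I.lNodes l).card : ℝ) + I.numNonLNodes l = Fintype.card I.V := by exact_mod_cast h₂
  rw [alpha, ge_iff_le, sub_le_iff_le_add, ← add_div, le_div_iff₀ hV] at h₁
  linarith

/-! ### Asymptotics -/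

theorem IsScanTime.le {I : MOWSP} {t l n : ℕ} (h : I.IsScanTime t)
    (hn : I.maxNonDominated l = (n : ℕ∞)) (hnK : (n : ℝ) ≤ (I.K : ℝ) / (I.W : ℝ)) :
    t ≤ (n * I.E.card + I.K * (I.maxOutDegree * I.numNonLNodes l)) * (1 + 3 * I.W) +
      n * Fintype.card I.V * (40 * I.W * (n + I.heapTime)) +
      I.K * (I.maxInDegree * I.numNonLNodes l) * (40 * I.W * (I.K + I.heapTime)) +
      I.initBestTime * I.numNonLNodes l := by
  obtain ⟨sample, σ, h⟩ := h
  -- The property of the sample is recorded only at the start of the execution.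
  have hs : I.IsParetoSample sample := by
    induction h with
    | init h => exact h
    | adapt _ _ _ ih => exact ih
    | develop _ _ _ _ _ _ _ _ _ _ ih => exact ih
  exact h.time_le hs (fun v hv => hn ▸ hs.encard_undominated_le hv) hnK

/-- Here `n = |V|`, `r = √n`, `x = log n`, and `M` counts the nodes that are not `L`-nodes. In the
edge term `N ≤ C L ≤ C L²`, in the node term `N ≤ C² x`; elsewhere `K² ≤ C² r² = C² n`, and heap
times are absorbed into `√n`. The constant is `170 = 4 + 80 + 80 + 6`. -/
theorem time_bound_aux {C E K W L N M din dout h n r x : ℝ} (hC : 1 ≤ C) (hE : 0 ≤ E)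
    (hK₀ : 0 ≤ K) (hW₀ : 0 ≤ W) (hN₀ : 0 ≤ N) (hM₀ : 0 ≤ M) (hdin₀ : 0 ≤ din)
    (hdout₀ : 0 ≤ dout) (hh₀ : 0 ≤ h) (hn : 1 ≤ n) (hr₀ : 0 ≤ r) (hr : r ^ 2 = n) (hx : 1 ≤ x)
    (hL : L ≤ L ^ 2) (hW : W ≤ C) (hdin : din ≤ C * x) (hdout : dout ≤ C * x) (hK : K ≤ C * r)
    (hNL : N ≤ C * L) (hLx : L ≤ C * x) (hM : M ≤ x) (hh : h ≤ C * x) (hxr : x ≤ C * r) :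
    (N * E + K * (dout * M)) * (1 + 3 * W) + N * n * (40 * W * (N + h)) +
      K * (din * M) * (40 * W * (K + h)) + 6 * W * K ^ 2 * M ≤
    170 * C ^ 5 * (E * L ^ 2 + n * x ^ 2) := by
  have hx₀ : 0 ≤ x := by linarith
  have hC₀ : 0 ≤ C := by linarith
  have hn₀ : 0 ≤ n := by linarith
  have hrn : r ≤ n := by nlinarith
  have hEL : 0 ≤ E * L ^ 2 := by positivity
  have hnx : 0 ≤ n * x ^ 2 := by positivity
  have hC2 : 1 ≤ C ^ 2 := one_le_pow₀ hC
  have hpow : ∀ k ≤ 5, C ^ k ≤ C ^ 5 := fun k hk => pow_le_pow_right₀ hC hk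
  have hNx : N ≤ C ^ 2 * x := by
    calc N ≤ C * (C * x) := hNL.trans (by gcongr)
      _ = C ^ 2 * x := by ring
  have hCx : C * x ≤ C ^ 2 * x := by
    have : C ≤ C ^ 2 := le_self_pow₀ hC two_ne_zero
    gcongr
  have h₁ : (N * E + K * (dout * M)) * (1 + 3 * W) ≤
      4 * C ^ 2 * (E * L ^ 2) + 4 * C ^ 3 * (n * x ^ 2) := by
    calc (N * E + K * (dout * M)) * (1 + 3 * W)
        ≤ ((C * L ^ 2) * E + (C * n) * ((C * x) * x)) * (C + 3 * C) := by
          gcongr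
          · exact hNL.trans (by gcongr)
          · exact hK.trans (by gcongr)
      _ = _ := by ring
  have h₂ : N * n * (40 * W * (N + h)) ≤ 80 * C ^ 5 * (n * x ^ 2) := by
    calc N * n * (40 * W * (N + h))
        ≤ (C ^ 2 * x) * n * (40 * C * (C ^ 2 * x + C ^ 2 * x)) := by
          gcongr
          exact hh.trans hCx
      _ = _ := by ring
  have h₃ : K * (din * M) * (40 * W * (K + h)) ≤ 80 * C ^ 5 * (n * x ^ 2) := by
    have hCr : C * r ≤ C ^ 2 * r := by
      have : C ≤ C ^ 2 := le_self_pow₀ hC two_ne_zero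
      gcongr
    calc K * (din * M) * (40 * W * (K + h))
        ≤ (C * r) * ((C * x) * x) * (40 * C * (C ^ 2 * r + C ^ 2 * r)) := by
          gcongr
          · exact hK.trans hCr
          · calc h ≤ C * (C * r) := hh.trans (by gcongr)
              _ = C ^ 2 * r := by ring
      _ = _ := by rw [← hr]; ring
  have h₄ : 6 * W * K ^ 2 * M ≤ 6 * C ^ 3 * (n * x ^ 2) := by
    calc 6 * W * K ^ 2 * M ≤ 6 * C * (C * r) ^ 2 * x ^ 2 := by
          gcongr
          exact hM.trans (le_self_pow₀ hx two_ne_zero)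
      _ = _ := by rw [← hr]; ring
  have h₅ := mul_le_mul_of_nonneg_right (hpow 2 (by norm_num)) hEL
  have h₆ := mul_le_mul_of_nonneg_right (hpow 3 (by norm_num)) hnx
  have h₇ : 0 ≤ C ^ 5 * (E * L ^ 2) := by positivity
  linarith

theorem logb_isBigO_sqrt (b : ℝ) :
    (fun n : ℕ => Real.logb b n) =O[Filter.atTop] fun n : ℕ => Real.sqrt n := by
  have h := (isLittleO_log_rpow_atTop (r := 1 / 2) (by norm_num)).isBigO.comp_tendsto
    (tendsto_natCast_atTop_atTop (R := ℝ))
  simp only [Function.comp_def, ← Real.sqrt_eq_rpow] at h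
  simpa only [Real.logb, div_eq_inv_mul] using h.const_mul_left (Real.log b)⁻¹

theorem log_two_isBigO_logb {b : ℝ} (hb : 1 < b) :
    (fun n : ℕ => ((1 + Nat.log 2 n : ℕ) : ℝ)) =O[Filter.atTop] fun n : ℕ => Real.logb b n := by
  have hlog : 0 < Real.log b := Real.log_pos hb
  have htop : Filter.Tendsto (fun n : ℕ => Real.logb b n) Filter.atTop Filter.atTop :=
    (Real.tendsto_logb_atTop hb).comp tendsto_natCast_atTop_atTop
  refine Asymptotics.IsBigO.of_bound (1 + Real.log b / Real.log 2) ?_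
  filter_upwards [htop.eventually_ge_atTop 1] with n hn
  have h₁ : (Nat.log 2 n : ℝ) ≤ Real.logb 2 n := by
    exact_mod_cast Real.natLog_le_logb n 2
  have h₂ : Real.logb 2 n = Real.log b / Real.log 2 * Real.logb b n := by
    simp only [Real.logb]
    field_simp
  rw [Real.norm_of_nonneg (by positivity), Real.norm_of_nonneg (by linarith)]
  push_cast
  linarith

end MOWSP

theorem theoremP9 {ι : Type*} (l : Filter ι) (I : ι → MOWSP) (b : ℝ) (hb : 1 < b)
    (L N : ι → ℕ) (F : ℕ → ℝ)
    -- asymptotics are with respect to the number of nodes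
    (hV : Filter.Tendsto (fun i => Fintype.card (I i).V) l Filter.atTop)
    -- `L` and `N_L`
    (hL : ∀ i, (I i).IsL b (L i))
    (hN : ∀ i, (I i).maxNonDominated (L i) = (N i : ℕ∞))
    -- the number of objectives is `O(1)`
    (hW : (fun i => ((I i).W : ℝ)) =O[l] fun _ => (1 : ℝ))
    -- the maximum degrees are `O(log |V|)`
    (hIn : (fun i => ((I i).maxInDegree : ℝ)) =O[l]
      fun i => Real.logb b (Fintype.card (I i).V : ℝ))
    (hOut : (fun i => ((I i).maxOutDegree : ℝ)) =O[l]
      fun i => Real.logb b (Fintype.card (I i).V : ℝ))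
    -- the number of coefficient vectors is `O(√|V|)`
    (hK : (fun i => ((I i).K : ℝ)) =O[l] fun i => Real.sqrt (Fintype.card (I i).V : ℝ))
    -- `N_L = O(L)` and `N_L ≤ K / W`
    (hNL : (fun i => (N i : ℝ)) =O[l] fun i => (L i : ℝ))
    (hNK : ∀ i, (N i : ℝ) ≤ ((I i).K : ℝ) / ((I i).W : ℝ))
    -- `L = O(F(|V|))` for a sub-logarithmic function `F`
    (hF : F =o[Filter.atTop] fun n : ℕ => Real.logb b (n : ℝ))
    (hLF : (fun i => (L i : ℝ)) =O[l] fun i => F (Fintype.card (I i).V))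
    -- `T i` is the scanning time of an execution on the `i`-th instance
    (T : ι → ℕ) (hT : ∀ i, (I i).IsScanTime (T i)) :
    (fun i => (T i : ℝ)) =O[l] fun i =>
      ((I i).E.card : ℝ) * (L i : ℝ) ^ 2 +
        (Fintype.card (I i).V : ℝ) * Real.logb b (Fintype.card (I i).V : ℝ) ^ 2 := by
  have hlog : Filter.Tendsto (fun i => Real.logb b (Fintype.card (I i).V : ℝ)) l Filter.atTop :=
    (Real.tendsto_logb_atTop hb).comp (tendsto_natCast_atTop_atTop.comp hV)
  have hLx : (fun i => (L i : ℝ)) =O[l] fun i => Real.logb b (Fintype.card (I i).V : ℝ) :=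
    hLF.trans (hF.isBigO.comp_tendsto hV)
  have hheap : (fun i => ((I i).heapTime : ℝ)) =O[l]
      fun i => Real.logb b (Fintype.card (I i).V : ℝ) :=
    (MOWSP.log_two_isBigO_logb hb).comp_tendsto hV
  have hsqrt : (fun i => Real.logb b (Fintype.card (I i).V : ℝ)) =O[l]
      fun i => Real.sqrt (Fintype.card (I i).V : ℝ) :=
    (MOWSP.logb_isBigO_sqrt b).comp_tendsto hV
  -- All sufficiently large constants work for each estimate, so a single `C ≥ 1` serves for all of
  -- them.
  have hbound : ∀ᶠ C : ℝ in Filter.atTop, 1 ≤ C ∧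
      Asymptotics.IsBigOWith C l (fun i => ((I i).W : ℝ)) (fun _ => (1 : ℝ)) ∧
      Asymptotics.IsBigOWith C l (fun i => ((I i).maxInDegree : ℝ))
        (fun i => Real.logb b (Fintype.card (I i).V : ℝ)) ∧
      Asymptotics.IsBigOWith C l (fun i => ((I i).maxOutDegree : ℝ))
        (fun i => Real.logb b (Fintype.card (I i).V : ℝ)) ∧
      Asymptotics.IsBigOWith C l (fun i => ((I i).K : ℝ))
        (fun i => Real.sqrt (Fintype.card (I i).V : ℝ)) ∧
      Asymptotics.IsBigOWith C l (fun i => (N i : ℝ)) (fun i => (L i : ℝ)) ∧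
      Asymptotics.IsBigOWith C l (fun i => (L i : ℝ))
        (fun i => Real.logb b (Fintype.card (I i).V : ℝ)) ∧
      Asymptotics.IsBigOWith C l (fun i => ((I i).heapTime : ℝ))
        (fun i => Real.logb b (Fintype.card (I i).V : ℝ)) ∧
      Asymptotics.IsBigOWith C l (fun i => Real.logb b (Fintype.card (I i).V : ℝ))
        (fun i => Real.sqrt (Fintype.card (I i).V : ℝ)) := by
    simp only [Asymptotics.isBigO_iff_eventually_isBigOWith] at hW hIn hOut hK hNL hLx hheap hsqrt
    filter_upwards [Filter.eventually_ge_atTop 1, hW, hIn, hOut, hK, hNL, hLx, hheap, hsqrt]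
      with C h₀ h₁ h₂ h₃ h₄ h₅ h₆ h₇ h₈
    exact ⟨h₀, h₁, h₂, h₃, h₄, h₅, h₆, h₇, h₈⟩
  obtain ⟨C, hC, hW, hIn, hOut, hK, hNL, hLx, hheap, hsqrt⟩ := hbound.exists
  refine Asymptotics.IsBigO.of_bound (170 * C ^ 5) ?_
  filter_upwards [hlog.eventually_ge_atTop 1, hW.bound, hIn.bound, hOut.bound, hK.bound, hNL.bound,
    hLx.bound, hheap.bound, hsqrt.bound] with i hx hW hIn hOut hK hNL hLx hheap hsqrt
  have hx₀ : 0 ≤ Real.logb b (Fintype.card (I i).V : ℝ) := zero_le_one.trans hx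
  simp only [Real.norm_natCast, norm_one, mul_one, Real.norm_of_nonneg hx₀,
    Real.norm_of_nonneg (Real.sqrt_nonneg _)] at hW hIn hOut hK hNL hLx hheap hsqrt
  have hn : (1 : ℝ) ≤ Fintype.card (I i).V := by
    exact_mod_cast Nat.succ_le_of_lt (Fintype.card_pos_iff.2 ⟨(I i).s⟩)
  have hLL : (L i : ℝ) ≤ (L i : ℝ) ^ 2 := by
    exact_mod_cast Nat.le_self_pow two_ne_zero (L i)
  have hTi : (T i : ℝ) ≤ _ := Nat.cast_le.2 ((hT i).le (hN i) (hNK i))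
  rw [Real.norm_natCast, Real.norm_of_nonneg (by positivity)]
  refine hTi.trans ?_
  simp only [MOWSP.initBestTime]
  push_cast
  exact MOWSP.time_bound_aux hC (by positivity) (by positivity) (by positivity) (by positivity)
    (by positivity) (by positivity) (by positivity) (by positivity) hn (Real.sqrt_nonneg _)
    (Real.sq_sqrt (by positivity)) hx hLL hW hIn hOut hK hNL hLx
    (MOWSP.numNonLNodes_le (hL i)) hheap hsqrt
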